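/- For a finite connected graph $G=(V,E)$, a local antimagic labeling is a bijection $f:E\to\{1,\dots,|E|\}$ such that $f^+(x)\ne f^+(y)$ for all adjacent $x,y$, where $f^+(x)$ is the sum of $f(e)$ over the edges $e$ incident to $x$; $\chi_{la}(G)$ is the least number of distinct values of $f^+$ over all such labelings. $C_m(a_0,\dots,a_k)$ denotes the circulant graph on $\mathbb Z_m$ in which $u,v$ are adjacent iff $u-v\equiv\pm a_i \pmod m$ for some $i$. A one-point union is obtained by merging one chosen vertex of each of the given graphs (vertex $0$ for a circulant graph on $\mathbb Z_m$). For $n\equiv 0\pmod 4$, let $\mathcal G_n$ be the set of all simple graphs of order $n/2$ that arise from the cycle $v_0v_1\cdots v_{n-1}$ by partitioning its even-indexed vertices into pairs and its odd-indexed vertices into pairs and merging the two vertices of each pair, where no multiple edges arise; the chosen vertex is the one containing $v_0$. **Theorem.** There are infinitely many pairwise non-isomorphic one-point unions of regular graphs, with all copies, except possibly one, circulant, that have $\chi_{la}=2$. More precisely, each of the following graphs is connected and has $\chi_{la}=2$. (A) For odd $r\ge 9$: the one-point union of $C_{4r-2}(1,a_h)$, $1\le h\le \frac{r-1}2$, and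 $H$, for any integers $1<a_h<2r-1$ with $\gcd(a_h,4r-2)=1$ and any $H\in\mathcal G_{2r-2}$. (B) For $r\equiv 1\pmod 4$, $r\ge 9$: the one-point union of $C_{2r}(1,a_h)$, $C_{2r-2}(1,b_h)$, $1\le h\le\frac{r-1}4$, and $H$, for any integers $1<a_h<r$ with $\gcd(a_h,2r)=1$, $1<b_h<r-1$ with $\gcd(b_h,2r-2)=1$, and any $H\in\mathcal G_{2r-2}$. For $s\ge 2$, $t\ge 0$ put $r=2^{2s-2}(t+2)+1$ and $K_{s,t}=C_{2^s(t+2)}(J)$ with $J=\{1+l(2t+4),\,2t+3+l(2t+4): 0\le l<2^{s-2}\}$. For an integer $m$, a jump set for $m$ is a set of $2^{s-1}$ positive integers that are smaller than $m/2$ and coprime to $m$, one of which is $1$. (C) The one-point union of $K_{s,t}$ and $C_{4r-2}(S_h)$, $1\le h\le 2^{s-1}(t+2)$, for any jump sets $S_h$ for $4r-2$. (D) The one-point union of $K_{s,t}$, $C_{2r}(S_h)$ and $C_{2r-2}(T_h)$, $1\le h\le 2^{s-2}(t+2)$, for any jump sets $S_h$ for $2r$ and $T_h$ for $2r-2$.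 In (A) and (B) the graph is a one-point union of at least two connected $4$-regular bipartite graphs, at most one of which is not circulant; in (C) and (D) it is a one-point union of at least two connected $2^s$-regular bipartite circulant graphs. The families (A) and (B) are non-empty for each such $r$; each of the families (A) and (B), and for every fixed $s\ge 2$ each of the families (C) and (D), contains infinitely many pairwise non-isomorphic graphs. -/

import Mathlib

namespace LocalAntimagic

/-! ### Local antimagic labelings -/

/-- The induced vertex label `f⁺(v)`: the sum of `f(e)` over the edges `e` incident to `v`. -/
noncomputable def vertexLabel {V : Type} (G : SimpleGraph V) (f : Sym2 V → ℕ) (v : V) : ℕ :=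
  ∑ᶠ e ∈ G.incidenceSet v, f e

/-- `f` restricts to a bijection `E(G) → {1, …, |E(G)|}` and adjacent vertices have distinct
induced labels. (The values of `f` off the edge set play no role.) -/
def IsLocalAntimagic {V : Type} (G : SimpleGraph V) (f : Sym2 V → ℕ) : Prop :=
  Set.BijOn f G.edgeSet (Set.Icc 1 G.edgeSet.ncard) ∧
    ∀ u v, G.Adj u v → vertexLabel G f u ≠ vertexLabel G f v

/-- The colour number `c(f)`: the number of distinct induced vertex labels. -/
noncomputable def colorNumber {V : Type} (G : SimpleGraph V) (f : Sym2 V → ℕ) : ℕ :=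
  (Set.range (vertexLabel G f)).ncard

/-- The local antimagic chromatic number `χ_la(G)` (with the value `0` if there is no
local antimagic labeling). -/
noncomputable def chiLa {V : Type} (G : SimpleGraph V) : ℕ :=
  sInf {c | ∃ f, IsLocalAntimagic G f ∧ colorNumber G f = c}

/-! ### One-point unions -/

/-- A graph with a chosen vertex. -/
structure RootedGraph where
  V : Type
  graph : SimpleGraph V
  root : V

/-- Vertices of the one-point union: the merged vertex `none`, and all non-root vertices. -/
abbrev UnionVertex {ι : Type} (H : ι → RootedGraph) : Type :=
  Option (Σ i, {v : (H i).V // v ≠ (H i).root})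

open Classical in
/-- The map of the `i`-th block into the one-point union; the root goes to the merged vertex. -/
noncomputable def blockMap {ι : Type} (H : ι → RootedGraph) (i : ι) (v : (H i).V) :
    UnionVertex H :=
  if h : v = (H i).root then none else some ⟨i, v, h⟩

/-- The one-point union: the disjoint union of the blocks `H i` with all the roots merged. -/
noncomputable def onePointUnion {ι : Type} (H : ι → RootedGraph) : RootedGraph where
  V := UnionVertex H
  graph := ⨆ i, (H i).graph.map (blockMap H i)
  root := none

/-! ### Circulant graphs and transformations of cycles -/

/-- The circulant graph `C_m(a : a ∈ S)` on `ℤ/m`, rooted at the vertex `0`. -/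
def circulant (m : ℕ) (S : Finset ℕ) : RootedGraph where
  V := ZMod m
  graph := SimpleGraph.circulantGraph ((fun a : ℕ => (a : ZMod m)) '' (S : Set ℕ))
  root := 0

/-- A graph is circulant if it is isomorphic to a circulant graph on some finite `ℤ/m`. -/
def IsCirculant {V : Type} (G : SimpleGraph V) : Prop :=
  ∃ m : ℕ, 1 ≤ m ∧ ∃ S : Set (ZMod m), Nonempty (G ≃g SimpleGraph.circulantGraph S)

/-- A partition of the vertices `v_0, …, v_{n-1}` of the cycle `C_n` into blocks of size two, each
consisting of two vertices with even subscripts or of two vertices with odd subscripts. -/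
def IsParityPairing (n : ℕ) (P : Setoid (ZMod n)) : Prop :=
  (∀ x : ZMod n, {y | P x y}.ncard = 2) ∧ ∀ x y : ZMod n, P x y → x.val % 2 = y.val % 2

/-- The graph obtained from the cycle `C_n` by merging the vertices in each block of `P`,
rooted at the vertex that contains `v_0`. -/
def mergedCycle (n : ℕ) (P : Setoid (ZMod n)) : RootedGraph where
  V := Quotient P
  graph := (circulant n {1}).graph.map (Quotient.mk P)
  root := Quotient.mk P (0 : ZMod n)

/-- Merging the blocks of `P` in `C_n` produces neither loops nor multiple edges. -/
def MergesSimply (n : ℕ) (P : Setoid (ZMod n)) : Prop :=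
  (∀ x y : ZMod n, (circulant n {1}).graph.Adj x y → ¬ P x y) ∧
    Set.InjOn (Sym2.map (Quotient.mk P)) (circulant n {1}).graph.edgeSet

/-- The jumps `1, 2t+3, 2t+5, 4t+7, …, 1+(2^(s-2)-1)(2t+4), 2t+3+(2^(s-2)-1)(2t+4)`. -/
def jumps (s t : ℕ) : Finset ℕ :=
  (Finset.range (2 ^ (s - 2))).image (fun l => 1 + l * (2 * t + 4)) ∪
    (Finset.range (2 ^ (s - 2))).image (fun l => 2 * t + 3 + l * (2 * t + 4))

/-- `S = {1, a_1, …, a_(q-1)}` has exactly `q` elements, all of them coprime to `m` and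
smaller than `m / 2`. -/
def IsJumpSet (m q : ℕ) (S : Finset ℕ) : Prop :=
  S.card = q ∧ 1 ∈ S ∧ ∀ a ∈ S, 2 * a < m ∧ Nat.Coprime a m

/-! ### The transformed one-point unions of cycles -/

/-- The graphs obtained from `U((4r-2)^[r-1], 2r-2)`: pairs of cycles `C_(4r-2)` become circulants
`C_(4r-2)(1, a_h)`, and `C_(2r-2)` becomes a simple graph by merging its vertices in pairs. -/
def familyA (r : ℕ) : Set RootedGraph :=
  {G | ∃ (a : Fin ((r - 1) / 2) → ℕ) (P : Setoid (ZMod (2 * r - 2))),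
    (∀ h, 1 < a h ∧ a h < 2 * r - 1 ∧ Nat.Coprime (a h) (4 * r - 2)) ∧
    IsParityPairing (2 * r - 2) P ∧ MergesSimply (2 * r - 2) P ∧
    G = onePointUnion (fun i : Option (Fin ((r - 1) / 2)) =>
      i.elim (mergedCycle (2 * r - 2) P) (fun h => circulant (4 * r - 2) {1, a h}))}

/-- The graphs obtained from `U((2r)^[(r-1)/2], (2r-2)^[(r+1)/2])`: pairs of cycles `C_(2r)` become
circulants `C_(2r)(1, a_h)`, pairs of cycles `C_(2r-2)` become circulants `C_(2r-2)(1, b_h)`, and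
the remaining `C_(2r-2)` becomes a simple graph by merging its vertices in pairs. -/
def familyB (r : ℕ) : Set RootedGraph :=
  {G | ∃ (a b : Fin ((r - 1) / 4) → ℕ) (P : Setoid (ZMod (2 * r - 2))),
    (∀ h, 1 < a h ∧ a h < r ∧ Nat.Coprime (a h) (2 * r)) ∧
    (∀ h, 1 < b h ∧ b h < r - 1 ∧ Nat.Coprime (b h) (2 * r - 2)) ∧
    IsParityPairing (2 * r - 2) P ∧ MergesSimply (2 * r - 2) P ∧
    G = onePointUnion (fun i : Option (Fin ((r - 1) / 4) ⊕ Fin ((r - 1) / 4)) =>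
      i.elim (mergedCycle (2 * r - 2) P)
        (Sum.elim (fun h => circulant (2 * r) {1, a h})
          (fun h => circulant (2 * r - 2) {1, b h})))}

/-- The graphs obtained from `U((4r-2)^[r-1], 2r-2)`, where `r = 2^(2s-2)(t+2)+1`: groups of
`2^(s-1)` cycles `C_(4r-2)` become `2^s`-regular circulants of order `4r-2`, and `C_(2r-2)` becomes
a `2^s`-regular circulant of order `2^s(t+2)`. -/
def familyC (s t r : ℕ) : Set RootedGraph :=
  {G | r = 2 ^ (2 * s - 2) * (t + 2) + 1 ∧ ∃ S : Fin (2 ^ (s - 1) * (t + 2)) → Finset ℕ,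
    (∀ h, IsJumpSet (4 * r - 2) (2 ^ (s - 1)) (S h)) ∧
    G = onePointUnion (fun i : Option (Fin (2 ^ (s - 1) * (t + 2))) =>
      i.elim (circulant (2 ^ s * (t + 2)) (jumps s t)) (fun h => circulant (4 * r - 2) (S h)))}

/-- The graphs obtained from `U((2r)^[(r-1)/2], (2r-2)^[(r+1)/2])`, where `r = 2^(2s-2)(t+2)+1`:
groups of `2^(s-1)` cycles `C_(2r)`, and groups of `2^(s-1)` cycles `C_(2r-2)`, become `2^s`-regular
circulants of orders `2r` and `2r-2`, and the remaining `C_(2r-2)` becomes a `2^s`-regular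
circulant of order `2^s(t+2)`. -/
def familyD (s t r : ℕ) : Set RootedGraph :=
  {G | r = 2 ^ (2 * s - 2) * (t + 2) + 1 ∧
    ∃ S T : Fin (2 ^ (s - 2) * (t + 2)) → Finset ℕ,
    (∀ h, IsJumpSet (2 * r) (2 ^ (s - 1)) (S h)) ∧
    (∀ h, IsJumpSet (2 * r - 2) (2 ^ (s - 1)) (T h)) ∧
    G = onePointUnion (fun i : Option
        (Fin (2 ^ (s - 2) * (t + 2)) ⊕ Fin (2 ^ (s - 2) * (t + 2))) =>
      i.elim (circulant (2 ^ s * (t + 2)) (jumps s t))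
        (Sum.elim (fun h => circulant (2 * r) (S h)) (fun h => circulant (2 * r - 2) (T h))))}

/-! ### The properties that are claimed -/

/-- `G` is (isomorphic to) a one-point union of at least two finite connected `d`-regular bipartite
graphs, of which at most `c` are not circulant. -/
def IsRegularUnion (d c : ℕ) (G : RootedGraph) : Prop :=
  ∃ (ι : Type) (H : ι → RootedGraph), Finite ι ∧ Nontrivial ι ∧
    (∀ i, Finite (H i).V ∧ (H i).graph.Connected ∧ (H i).graph.IsBipartite ∧
      ∀ v, ((H i).graph.neighborSet v).ncard = d) ∧
    {i | ¬ IsCirculant (H i).graph}.ncard ≤ c ∧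
    Nonempty (G.graph ≃g (onePointUnion H).graph)

/-- `G` is a finite connected graph with `χ_la(G) = 2`. -/
def HasChiLaTwo (G : RootedGraph) : Prop :=
  Finite G.V ∧ G.graph.Connected ∧ chiLa G.graph = 2

/-- The set `F` contains infinitely many pairwise non-isomorphic graphs. -/
def InfinitelyMany (F : Set RootedGraph) : Prop :=
  ∃ G : ℕ → RootedGraph, (∀ k, G k ∈ F) ∧
    Pairwise (fun i j => IsEmpty ((G i).graph ≃g (G j).graph))

end LocalAntimagic

open LocalAntimagic

namespace LocalAntimagic

/-! ### Vertex labels read along a traversal of the edges -/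

section Traversal

variable {V Pos : Type} {G : SimpleGraph V} {next : Equiv.Perm Pos} {w : Pos → V}

/-! Every graph in the four families arises from a one-point union of even cycles by merging
vertices that lie on the same side of the bipartition, and a good labeling of the cycles survives
the merging. It therefore suffices to work with closed trails through the root.

Along a trail of length 2k, place the labels a, c+(k-1)d, a+d, c+(k-2)d, ..., a+(k-1)d, c. If
a+c+(k-1)d = x for every trail, then the two labels met at an odd position have sum x, and those at
an even position other than the start have sum x+d. In a block whose trails pass every vertex p
times, the vertices on the odd side get p*x and the non-root vertices on the even side get p*(x+d).
A circulant block with p jumps coprime to its order consists of p Hamiltonian cycles through the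
root; the one exceptional block is a single trail that visits its root p times. Hence exactly p-1 of
the passes through the merged root lie inside a trail. They give (p-1)*(x+d), so the root gets
p*(x+d) as soon as the sums a+c at the starts of all trails add up to x+d. This is
`chiLa_onePointUnion`; two values are also necessary, since adjacent vertices differ.

The arithmetic is in `labelScheme_first` and `labelScheme_second`: the labels 1, ..., x-1 are split
by residue modulo d, residues are paired with a constant sum, and each trail takes a pair, its even
positions running up one class and its odd positions running down the other. In the first scheme one
shorter trail uses the class of multiples of d alone.

The covers come from three sources: multiples of a unit jump (`circulantCover`), the cycle itself
for a merged cycle (`mergedCycleCover`), and an explicit Euler circuit for the circulant with jumps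
congruent to 1 or -1 modulo 2t+4 (`jumpsCover`). Members of the families are built in
`exists_mergesSimply` and the jump set lemmas, and they are told apart by their numbers of edges,
x-1. -/

theorem traversal_ne (h : Set.BijOn (fun x => s(w x, w (next x))) Set.univ G.edgeSet) (x : Pos) :
    w x ≠ w (next x) :=
  G.ne_of_adj (SimpleGraph.mem_edgeSet G |>.mp (h.mapsTo (Set.mem_univ x)))

theorem bijOn_incidenceSet (h : Set.BijOn (fun x => s(w x, w (next x))) Set.univ G.edgeSet)
    (v : V) :
    Set.BijOn (fun x => s(w x, w (next x))) {x | w x = v ∨ w (next x) = v}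
      (G.incidenceSet v) := by
  refine ⟨fun x hx => ⟨h.mapsTo (Set.mem_univ x), ?_⟩,
    h.injOn.mono (Set.subset_univ _), fun e he => ?_⟩
  · rcases hx with hx | hx <;> simp [← hx]
  · obtain ⟨x, -, rfl⟩ := h.surjOn he.1
    have hv := he.2
    simp only [Sym2.mem_iff] at hv
    exact ⟨x, hv.imp Eq.symm Eq.symm, rfl⟩

/-- Every pass through v uses one outgoing and one incoming edge. As there are no loops, no position
is counted both as leaving and as entering v, so each incident edge occurs exactly once. -/
theorem vertexLabel_eq_sum [Fintype Pos] [DecidableEq V]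
    (h : Set.BijOn (fun x => s(w x, w (next x))) Set.univ G.edgeSet) (f : Sym2 V → ℕ) (v : V) :
    vertexLabel G f v =
      ∑ x with w x = v, (f s(w x, w (next x)) + f s(w (next.symm x), w x)) := by
  classical
  unfold vertexLabel
  have hfin : {x | w x = v ∨ w (next x) = v} =
      (((Finset.univ.filter fun x => w x = v) ∪ (Finset.univ.filter fun x => w (next x) = v) :
        Finset Pos) : Set Pos) := by
    ext; simp
  rw [← finsum_mem_eq_of_bijOn _ (bijOn_incidenceSet h v) (fun _ _ => rfl), hfin,
    finsum_mem_coe_finset, Finset.sum_union, Finset.sum_add_distrib]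
  · congr 1
    refine Finset.sum_equiv next (by simp) (by simp)
  · rw [Finset.disjoint_filter]
    intro x _ h1 h2
    exact traversal_ne h x (h1.trans h2.symm)

theorem ncard_neighborSet_eq [Finite Pos]
    (h : Set.BijOn (fun x => s(w x, w (next x))) Set.univ G.edgeSet) (v : V) :
    (G.neighborSet v).ncard = 2 * {x | w x = v}.ncard := by
  classical
  have := Fintype.ofFinite Pos
  have h1 : (G.neighborSet v).ncard = (G.incidenceSet v).ncard := by
    rw [← Nat.card_coe_set_eq, ← Nat.card_coe_set_eq]
    exact Nat.card_congr (G.incidenceSetEquivNeighborSet v).symm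
  have h2 := vertexLabel_eq_sum h (fun _ => 1) v
  have hfin : (G.incidenceSet v).Finite :=
    (bijOn_incidenceSet h v).image_eq ▸ (Set.toFinite _).image _
  unfold vertexLabel at h2
  rw [finsum_mem_eq_finite_toFinset_sum _ hfin, Finset.sum_const, smul_eq_mul, mul_one,
    ← Set.ncard_eq_toFinset_card _ hfin] at h2
  rw [h1, h2, Finset.sum_const, smul_eq_mul, mul_comm, ← Set.ncard_coe_finset]
  simp

theorem ncard_edgeSet_eq
    (h : Set.BijOn (fun x => s(w x, w (next x))) Set.univ G.edgeSet) :
    G.edgeSet.ncard = Nat.card Pos := by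
  rw [← h.image_eq, h.injOn.ncard_image, Set.ncard_univ]

theorem two_le_colorNumber [Finite V] {u v : V} (huv : G.Adj u v) {f : Sym2 V → ℕ}
    (hf : IsLocalAntimagic G f) : 2 ≤ colorNumber G f := by
  unfold colorNumber
  rw [← Set.ncard_pair (hf.2 u v huv)]
  refine Set.ncard_le_ncard ?_ (Set.finite_range _)
  rintro _ (rfl | rfl) <;> exact ⟨_, rfl⟩

/-- A bijective labeling along a traversal whose pass sums are `X` on one side of a bipartition
and `Y` on the other one shows that the local antimagic chromatic number is two. -/
theorem chiLa_eq_two_of_traversal [Fintype Pos] [Nonempty Pos] [Finite V] [DecidableEq V]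
    (h : Set.BijOn (fun x => s(w x, w (next x))) Set.univ G.edgeSet)
    {side : V → ZMod 2} (hside : ∀ x, side (w (next x)) = side (w x) + 1)
    {l : Pos → ℕ} (hinj : Function.Injective l) (hl : ∀ x, l x ∈ Set.Icc 1 (Fintype.card Pos))
    {X Y : ℕ} (hXY : X ≠ Y)
    (hsum : ∀ v, ∑ x with w x = v, (l x + l (next.symm x)) = if side v = 0 then Y else X) :
    chiLa G = 2 := by
  classical
  have hei : Function.Injective (fun x => s(w x, w (next x))) := Set.injOn_univ.mp h.injOn
  -- The value 0 off the edges is arbitrary.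
  set f : Sym2 V → ℕ := Function.extend (fun x => s(w x, w (next x))) l 0 with hf
  have hfe : ∀ x, f s(w x, w (next x)) = l x := fun x => hei.extend_apply l 0 x
  have hvl : ∀ v, vertexLabel G f v = if side v = 0 then Y else X := by
    intro v
    rw [vertexLabel_eq_sum h, ← hsum]
    refine Finset.sum_congr rfl fun x _ => ?_
    have := hfe (next.symm x)
    rw [Equiv.apply_symm_apply] at this
    rw [hfe, this]
  have hadj : ∀ u v, G.Adj u v → side v = side u + 1 := by
    intro u v huv
    obtain ⟨x, -, hx⟩ := h.surjOn ((SimpleGraph.mem_edgeSet G).mpr huv)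
    have h2 := hside x
    rcases Sym2.eq_iff.mp hx with ⟨h3, h4⟩ | ⟨h3, h4⟩ <;> rw [h3, h4] at h2
    · exact h2
    · rw [h2, add_assoc]; exact (by decide : ∀ a : ZMod 2, a = a + (1 + 1)) _
  have hz : ∀ a : ZMod 2, (a + 1 = 0 ↔ a ≠ 0) := by decide
  have hla : IsLocalAntimagic G f := by
    constructor
    · rw [ncard_edgeSet_eq h, Nat.card_eq_fintype_card]
      have hb : Set.BijOn l Set.univ (Set.Icc 1 (Fintype.card Pos)) := by
        refine ⟨fun x _ => hl x, hinj.injOn, ?_⟩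
        -- Surjectivity by counting: an injective map from `Pos` into an interval with as many
        -- elements.
        have : Finset.univ.image l = Finset.Icc 1 (Fintype.card Pos) := by
          refine Finset.eq_of_subset_of_card_le ?_ ?_
          · intro y hy
            obtain ⟨x, -, rfl⟩ := Finset.mem_image.mp hy
            exact Finset.mem_Icc.mpr (hl x)
          · rw [Finset.card_image_of_injective _ hinj]; simp
        intro y hy
        have hy' : y ∈ Finset.univ.image l := by rw [this]; simpa using hy
        simpa using hy'
      refine ⟨fun e he => ?_, fun e he e' he' hee => ?_, fun y hy => ?_⟩
      · obtain ⟨x, -, rfl⟩ := h.surjOn he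
        simp only [hfe]; exact hl x
      · obtain ⟨x, -, rfl⟩ := h.surjOn he
        obtain ⟨x', -, rfl⟩ := h.surjOn he'
        simp only [hfe] at hee
        rw [hinj hee]
      · obtain ⟨x, -, rfl⟩ := hb.surjOn hy
        exact ⟨_, h.mapsTo (Set.mem_univ x), hfe x⟩
    · intro u v huv
      rw [hvl, hvl, hadj u v huv]
      by_cases h0 : side u = 0
      · simp [h0, Ne.symm hXY]
      · rw [if_neg h0, if_pos ((hz _).mpr h0)]; exact hXY
  obtain ⟨x⟩ := ‹Nonempty Pos›
  have hx : G.Adj (w x) (w (next x)) := (SimpleGraph.mem_edgeSet G).mp (h.mapsTo (Set.mem_univ x))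
  have hc : colorNumber G f = 2 := by
    refine le_antisymm ?_ (two_le_colorNumber hx hla)
    unfold colorNumber
    rw [← Set.ncard_pair hXY]
    refine Set.ncard_le_ncard ?_ (Set.toFinite _)
    rintro _ ⟨v, rfl⟩
    rw [hvl]
    split_ifs <;> simp
  refine le_antisymm (Nat.sInf_le ⟨f, hla, hc⟩) (le_csInf ⟨2, f, hla, hc⟩ ?_)
  rintro _ ⟨g, hg, rfl⟩
  exact two_le_colorNumber hx hg

theorem isBipartite_of_traversal
    (h : Set.BijOn (fun x => s(w x, w (next x))) Set.univ G.edgeSet)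
    {side : V → ZMod 2} (hside : ∀ x, side (w (next x)) = side (w x) + 1) : G.IsBipartite := by
  refine ⟨SimpleGraph.Coloring.mk (fun v => (side v : Fin 2)) ?_⟩
  intro u v huv heq
  obtain ⟨x, -, hx⟩ := h.surjOn ((SimpleGraph.mem_edgeSet G).mpr huv)
  have h2 := hside x
  have heq' : side u = side v := heq
  rcases Sym2.eq_iff.mp hx with ⟨h3, h4⟩ | ⟨h3, h4⟩ <;>
    · rw [h3, h4, heq'] at h2
      exact absurd h2 ((by decide : ∀ a : ZMod 2, a ≠ a + 1) _)

end Traversal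

/-! ### Blocks covered by closed trails at the root -/

/-- A decomposition of a rooted graph with a bipartition into closed trails of length `n` that
start at the root, such that the trails visit every vertex `p` times. -/
structure CircuitCover (Γ : RootedGraph) (p : ℕ) (J : Type) (n : ℕ) where
  walk : J → ZMod n → Γ.V
  walk_zero : ∀ j, walk j 0 = Γ.root
  side : Γ.V → ZMod 2
  side_root : side Γ.root = 0
  side_succ : ∀ j i, side (walk j (i + 1)) = side (walk j i) + 1
  edge_bijOn : Set.BijOn (fun x : J × ZMod n => s(walk x.1 x.2, walk x.1 (x.2 + 1))) Set.univ
    Γ.graph.edgeSet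
  visits : ∀ v, {x : J × ZMod n | walk x.1 x.2 = v}.ncard = p

/-- The step along each of the closed trails. -/
def stepPerm (J : Type) (n : ℕ) : Equiv.Perm (J × ZMod n) :=
  (Equiv.refl J).prodCongr (Equiv.addRight 1)

namespace CircuitCover

variable {Γ : RootedGraph} {p : ℕ} {J : Type} {n : ℕ}

theorem bijOn_stepPerm (C : CircuitCover Γ p J n) : Set.BijOn (fun x : J × ZMod n =>
    s(C.walk x.1 x.2, C.walk (stepPerm J n x).1 (stepPerm J n x).2)) Set.univ Γ.graph.edgeSet :=
  C.edge_bijOn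

theorem isBipartite (C : CircuitCover Γ p J n) : Γ.graph.IsBipartite :=
  isBipartite_of_traversal (w := fun x : J × ZMod n => C.walk x.1 x.2) C.bijOn_stepPerm
    (side := C.side) fun x => C.side_succ x.1 x.2

theorem ncard_neighborSet (C : CircuitCover Γ p J n) [Finite J] [NeZero n] (v : Γ.V) :
    (Γ.graph.neighborSet v).ncard = 2 * p := by
  rw [ncard_neighborSet_eq (w := fun x : J × ZMod n => C.walk x.1 x.2) C.bijOn_stepPerm, C.visits]

theorem exists_walk_eq (C : CircuitCover Γ p J n) (hp : 1 ≤ p) (v : Γ.V) :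
    ∃ j i, C.walk j i = v := by
  have h : {x : J × ZMod n | C.walk x.1 x.2 = v}.Nonempty := by
    apply Set.nonempty_of_ncard_ne_zero
    rw [C.visits]; lia
  obtain ⟨⟨j, i⟩, hx⟩ := h
  exact ⟨j, i, hx⟩

theorem finite_V (C : CircuitCover Γ p J n) [Finite J] [NeZero n] (hp : 1 ≤ p) : Finite Γ.V :=
  Finite.of_surjective (fun x : J × ZMod n => C.walk x.1 x.2) fun v => by
    obtain ⟨j, i, h⟩ := C.exists_walk_eq hp v
    exact ⟨(j, i), h⟩

theorem reachable_root (C : CircuitCover Γ p J n) [NeZero n] (hp : 1 ≤ p) (v : Γ.V) :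
    Γ.graph.Reachable Γ.root v := by
  obtain ⟨j, i, rfl⟩ := C.exists_walk_eq hp v
  rw [← ZMod.natCast_zmod_val i]
  induction i.val with
  | zero => rw [Nat.cast_zero, C.walk_zero]
  | succ k ih =>
    refine ih.trans (SimpleGraph.Adj.reachable ?_)
    rw [Nat.cast_succ]
    exact (SimpleGraph.mem_edgeSet _).mp
      (C.edge_bijOn.mapsTo (Set.mem_univ (j, (k : ZMod n))))

theorem connected (C : CircuitCover Γ p J n) [NeZero n] (hp : 1 ≤ p) : Γ.graph.Connected :=
  (SimpleGraph.connected_iff_exists_forall_reachable _).mpr ⟨Γ.root, C.reachable_root hp⟩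

theorem side_walk (C : CircuitCover Γ p J n) [NeZero n] (j : J) (i : ZMod n) :
    C.side (C.walk j i) = (i.val : ZMod 2) := by
  have h : ∀ k : ℕ, C.side (C.walk j (k : ZMod n)) = (k : ZMod 2) := by
    intro k
    induction k with
    | zero => rw [Nat.cast_zero, Nat.cast_zero, C.walk_zero, C.side_root]
    | succ k ih => rw [Nat.cast_succ, C.side_succ, ih, Nat.cast_succ]
  rw [← h, ZMod.natCast_zmod_val]

theorem side_walk_eq_zero_iff (C : CircuitCover Γ p J n) [NeZero n] (j : J) (i : ZMod n) :
    C.side (C.walk j i) = 0 ↔ i.val % 2 = 0 := by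
  rw [C.side_walk, ZMod.natCast_eq_zero_iff]; lia

end CircuitCover

/-! ### Covers and labels of one-point unions -/

section Union

variable {B : Type} {H : B → RootedGraph}

theorem blockMap_root (b : B) : blockMap H b (H b).root = none := by simp [blockMap]

theorem blockMap_eq_none_iff {b : B} {v : (H b).V} : blockMap H b v = none ↔ v = (H b).root := by
  simp [blockMap]

theorem blockMap_eq_some_iff {b : B} {v : (H b).V} {z : Σ i, {v : (H i).V // v ≠ (H i).root}} :
    blockMap H b v = some z ↔ ∃ h : v ≠ (H b).root, (⟨b, v, h⟩ : Σ _, _) = z := by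
  by_cases h : v = (H b).root <;> simp [blockMap, h]

theorem blockMap_injective (b : B) : Function.Injective (blockMap H b) := by
  intro u v huv
  by_cases h : u = (H b).root
  · rw [h, blockMap_root] at huv
    rw [h, blockMap_eq_none_iff.mp huv.symm]
  · have h1 : blockMap H b u = some ⟨b, u, h⟩ := blockMap_eq_some_iff.mpr ⟨h, rfl⟩
    rw [h1] at huv
    obtain ⟨h2, h3⟩ := blockMap_eq_some_iff.mp huv.symm
    cases h3; rfl

theorem exists_blockMap_eq [Nonempty B] (v : UnionVertex H) : ∃ b u, blockMap H b u = v := by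
  rcases v with _ | ⟨b, u, h⟩
  · obtain ⟨b⟩ := ‹Nonempty B›
    exact ⟨b, _, blockMap_root b⟩
  · exact ⟨b, u, blockMap_eq_some_iff.mpr ⟨h, rfl⟩⟩

theorem onePointUnion_adj {u v : UnionVertex H} : (onePointUnion H).graph.Adj u v ↔
    ∃ b u' v', (H b).graph.Adj u' v' ∧ blockMap H b u' = u ∧ blockMap H b v' = v := by
  change (⨆ b, (H b).graph.map (blockMap H b)).Adj u v ↔ _
  rw [SimpleGraph.iSup_adj]
  exact exists_congr fun b => SimpleGraph.map_adj ⟨_, blockMap_injective b⟩ _ _ _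

/-- The blocks embed into the one-point union. -/
noncomputable def blockHom (H : B → RootedGraph) (b : B) :
    (H b).graph →g (onePointUnion H).graph where
  toFun := blockMap H b
  map_rel' h := onePointUnion_adj.mpr ⟨b, _, _, h, rfl, rfl⟩

/-- An edge has at least one end other than the root, and such a vertex belongs to only one block.
So different blocks share no edges. -/
theorem block_eq_of_map_eq {b b' : B} {e : Sym2 (H b).V} {e' : Sym2 (H b').V}
    (he : e ∈ (H b).graph.edgeSet) (h : Sym2.map (blockMap H b) e = Sym2.map (blockMap H b') e') :
    b = b' := by
  induction e with
  | _ u v =>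
  have huv : u ≠ v := ((H b).graph.mem_edgeSet.mp he).ne
  have key : ∀ z : (H b).V, z ∈ s(u, v) → z ≠ (H b).root → b = b' := by
    intro z hz hne
    have h1 : blockMap H b z ∈ Sym2.map (blockMap H b') e' :=
      h ▸ Sym2.mem_map.mpr ⟨z, hz, rfl⟩
    obtain ⟨z', -, h2⟩ := Sym2.mem_map.mp h1
    rw [(blockMap_eq_some_iff (v := z)).mpr ⟨hne, rfl⟩] at h2
    obtain ⟨h3, h4⟩ := blockMap_eq_some_iff.mp h2
    exact (congrArg Sigma.fst h4).symm
  by_cases hu : u = (H b).root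
  · exact key v (by simp) (fun hv => huv (hu.trans hv.symm))
  · exact key u (by simp) hu

variable {p : ℕ} {J : B → Type} {n : B → ℕ} (C : ∀ b, CircuitCover (H b) p (J b) (n b))

/-- The closed trails of the blocks as closed trails of the one-point union. -/
noncomputable def unionWalk (x : Σ b, J b × ZMod (n b)) : (onePointUnion H).V :=
  blockMap H x.1 ((C x.1).walk x.2.1 x.2.2)

theorem unionWalk_bijOn : Set.BijOn
    (fun x => s(unionWalk C x, unionWalk C (Equiv.sigmaCongrRight
      (fun b => stepPerm (J b) (n b)) x))) Set.univ (onePointUnion H).graph.edgeSet := by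
  have hE : ∀ x : Σ b, J b × ZMod (n b), s(unionWalk C x, unionWalk C (Equiv.sigmaCongrRight
      (fun b => stepPerm (J b) (n b)) x)) = Sym2.map (blockMap H x.1)
        s((C x.1).walk x.2.1 x.2.2, (C x.1).walk x.2.1 (x.2.2 + 1)) := fun _ => rfl
  refine ⟨fun x _ => ?_, ?_, ?_⟩
  · exact onePointUnion_adj.mpr ⟨x.1, _, _, (C x.1).edge_bijOn.mapsTo (Set.mem_univ x.2), rfl, rfl⟩
  · rintro ⟨b, x⟩ - ⟨b', x'⟩ - h
    simp only [hE] at h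
    obtain rfl := block_eq_of_map_eq ((C b).edge_bijOn.mapsTo (Set.mem_univ x)) h
    have := Sym2.map.injective (blockMap_injective b) h
    rw [(C b).edge_bijOn.injOn (Set.mem_univ x) (Set.mem_univ x') this]
  · intro e he
    induction e with
    | _ u v =>
    obtain ⟨b, u', v', h, rfl, rfl⟩ := onePointUnion_adj.mp he
    obtain ⟨x, -, hx⟩ := (C b).edge_bijOn.surjOn ((SimpleGraph.mem_edgeSet _).mpr h)
    refine ⟨⟨b, x⟩, Set.mem_univ _, ?_⟩
    exact (hE ⟨b, x⟩).trans (congrArg (Sym2.map (blockMap H b)) hx)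

theorem ncard_edgeSet_onePointUnion
    (C : ∀ b, CircuitCover (H b) p (J b) (n b)) :
    (onePointUnion H).graph.edgeSet.ncard = Nat.card (Σ b, J b × ZMod (n b)) :=
  ncard_edgeSet_eq (unionWalk_bijOn C)

theorem finite_onePointUnion
    (C : ∀ b, CircuitCover (H b) p (J b) (n b)) [Finite B] [∀ b, Finite (J b)]
    [∀ b, NeZero (n b)] (hp : 1 ≤ p) :
    Finite (onePointUnion H).V := by
  have := fun b => (C b).finite_V hp
  exact inferInstanceAs (Finite (Option (Σ i, {v : (H i).V // v ≠ (H i).root})))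

theorem connected_onePointUnion
    (C : ∀ b, CircuitCover (H b) p (J b) (n b)) [Nonempty B]
    [∀ b, NeZero (n b)] (hp : 1 ≤ p) :
    (onePointUnion H).graph.Connected := by
  refine (SimpleGraph.connected_iff_exists_forall_reachable _).mpr
    ⟨(none : UnionVertex H), fun v => ?_⟩
  obtain ⟨b, u, rfl⟩ := exists_blockMap_eq v
  have h := ((C b).reachable_root hp u).map (blockHom H b)
  have h2 : blockHom H b (H b).root = (none : UnionVertex H) := blockMap_root b
  rwa [h2] at h

/-- The bipartition of the one-point union. -/
def unionSide (v : (onePointUnion H).V) : ZMod 2 :=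
  match (v : UnionVertex H) with
  | none => 0
  | some z => (C z.1).side z.2.1

theorem unionSide_blockMap (b : B) (v : (H b).V) :
    unionSide C (blockMap H b v) = (C b).side v := by
  by_cases h : v = (H b).root
  · rw [h, blockMap_root, (C b).side_root]; rfl
  · rw [(blockMap_eq_some_iff (v := v)).mpr ⟨h, rfl⟩]; rfl

open Classical in
-- Of the p passes through the root of block b, one per trail is its start; each of the others
-- contributes y. The identity is stated additively to avoid truncated subtraction.
theorem sum_root_add [Fintype B] [∀ b, Fintype (J b)] [∀ b, NeZero (n b)] (b : B)
    {y : ℕ} {g : J b × ZMod (n b) → ℕ}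
    (hg : ∀ j i, i ≠ 0 → i.val % 2 = 0 → g (j, i) = y) :
    ∑ x with (C b).walk x.1 x.2 = (H b).root, g x + Fintype.card (J b) * y =
      p * y + ∑ j, g (j, 0) := by
  have hstart : ∀ c : J b × ZMod (n b) → ℕ,
      ∑ x with (C b).walk x.1 x.2 = (H b).root, (if x.2 = 0 then c x else 0) =
        ∑ j, c (j, 0) := by
    intro c
    rw [← Finset.sum_filter, Finset.filter_filter]
    symm
    refine Finset.sum_bij (fun j _ => (j, 0)) ?_ ?_ ?_ ?_
    · intro j _; simp [(C b).walk_zero]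
    · intro j _ j' _ h; simpa using h
    · rintro ⟨j, i⟩ h
      simp only [Finset.mem_filter, Finset.mem_univ, true_and] at h
      exact ⟨j, Finset.mem_univ _, by rw [h.2]⟩
    · intros; rfl
  have hcard : (Finset.univ.filter fun x : J b × ZMod (n b) =>
      (C b).walk x.1 x.2 = (H b).root).card = p := by
    have := (C b).visits (H b).root
    rw [← Set.ncard_coe_finset]; simpa using this
  have hpy : p * y = ∑ x : J b × ZMod (n b) with (C b).walk x.1 x.2 = (H b).root, y := by
    rw [Finset.sum_const, hcard, smul_eq_mul]
  have h1 : Fintype.card (J b) * y = ∑ j : J b, (fun _ : J b × ZMod (n b) => y) (j, 0) := by simp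
  rw [h1, ← hstart (fun _ => y), ← hstart g, hpy, ← Finset.sum_add_distrib,
    ← Finset.sum_add_distrib]
  refine Finset.sum_congr rfl ?_
  rintro ⟨j, i⟩ h
  by_cases hi : i = 0
  · simp [hi, add_comm]
  · have h2 : (C b).walk j i = (H b).root := by simpa using h
    have h3 := (C b).side_walk_eq_zero_iff j i
    rw [h2, (C b).side_root] at h3
    simp [hi, hg j i hi (h3.mp rfl)]

/-- The p passes through a non-root vertex contribute x or y each, according to its side, so the
colours are p*x and p*y. By `hcard`, all but p-1 of the passes through the merged root are starts of
trails; the starts together supply one further y by `hstart`. -/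
theorem chiLa_onePointUnion
    (C : ∀ b, CircuitCover (H b) p (J b) (n b)) [Fintype B] [Nonempty B] [∀ b, Fintype (J b)]
    [∀ b, Nonempty (J b)] [∀ b, NeZero (n b)] (hp : 1 ≤ p) {l : (Σ b, J b × ZMod (n b)) → ℕ}
    (hinj : Function.Injective l)
    (hl : ∀ x, l x ∈ Set.Icc 1 (Fintype.card (Σ b, J b × ZMod (n b))))
    {x y : ℕ} (hxy : x ≠ y)
    (hodd : ∀ b j i, i.val % 2 = 1 → l ⟨b, j, i⟩ + l ⟨b, j, i - 1⟩ = x)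
    (heven : ∀ b j i, i ≠ 0 → i.val % 2 = 0 → l ⟨b, j, i⟩ + l ⟨b, j, i - 1⟩ = y)
    (hstart : ∑ b, ∑ j : J b, (l ⟨b, j, 0⟩ + l ⟨b, j, 0 - 1⟩) = y)
    (hcard : Fintype.card B * p + 1 = p + ∑ b, Fintype.card (J b)) :
    chiLa (onePointUnion H).graph = 2 := by
  classical
  have := finite_onePointUnion C hp
  have : Nonempty (Σ b, J b × ZMod (n b)) := by
    obtain ⟨b⟩ := ‹Nonempty B›
    exact ⟨⟨b, Classical.arbitrary _, 0⟩⟩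
  refine chiLa_eq_two_of_traversal (unionWalk_bijOn C) (side := unionSide C) ?_ hinj hl
    (X := p * x) (Y := p * y) (by simpa [Nat.pos_iff_ne_zero.mp hp] using hxy) ?_
  · rintro ⟨b, j, i⟩
    change unionSide C (blockMap H b ((C b).walk j (i + 1))) =
      unionSide C (blockMap H b ((C b).walk j i)) + 1
    rw [unionSide_blockMap, unionSide_blockMap, (C b).side_succ]
  · intro v
    set g : (Σ b, J b × ZMod (n b)) → ℕ := fun z => l z + l ⟨z.1, z.2.1, z.2.2 - 1⟩ with hg
    have hgl : ∀ z, l z + l ((Equiv.sigmaCongrRight fun b => stepPerm (J b) (n b)).symm z) = g z :=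
      fun z => by
        rw [hg]; congr 2
        obtain ⟨b, j, i⟩ := z
        simp [stepPerm, sub_eq_add_neg]
    simp only [hgl]
    have hsplit : ∑ z with unionWalk C z = v, g z =
        ∑ b, ∑ z : J b × ZMod (n b) with blockMap H b ((C b).walk z.1 z.2) = v, g ⟨b, z⟩ := by
      rw [Finset.sum_filter, Fintype.sum_sigma]
      refine Finset.sum_congr rfl fun b _ => ?_
      rw [Finset.sum_filter]
      refine Finset.sum_congr rfl fun z _ => ?_
      unfold unionWalk
      split_ifs <;> first | rfl | contradiction
    rw [hsplit]
    rcases v with _ | ⟨b, v, hv⟩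
    · have h1 : ∀ b, ∑ z with blockMap H b ((C b).walk z.1 z.2) = none, g ⟨b, z⟩ +
          Fintype.card (J b) * y = p * y + ∑ j, g ⟨b, j, 0⟩ := by
        intro b
        have := sum_root_add C b (g := fun z => g ⟨b, z⟩) (heven b)
        simpa only [blockMap_eq_none_iff] using this
      have h2 := Finset.sum_congr rfl fun b (_ : b ∈ Finset.univ) => h1 b
      rw [Finset.sum_add_distrib, Finset.sum_add_distrib, ← Finset.sum_mul, hstart,
        Finset.sum_const, Finset.card_univ, smul_eq_mul] at h2
      have h3 : unionSide C (none : UnionVertex H) = 0 := rfl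
      rw [if_pos h3]
      have h4 : Fintype.card B * (p * y) + y = p * y + (∑ b, Fintype.card (J b)) * y := by
        rw [← mul_assoc, ← add_mul, ← hcard]; ring
      have h5 : ∑ b, ∑ z with blockMap H b ((C b).walk z.1 z.2) = none, g ⟨b, z⟩ = p * y := by lia
      convert h5
    · have h0 : ∀ b', b' ≠ b → ∑ z : J b' × ZMod (n b') with
          blockMap H b' ((C b').walk z.1 z.2) = some ⟨b, v, hv⟩, g ⟨b', z⟩ = 0 := by
        intro b' hb
        rw [Finset.sum_eq_zero]
        intro z hz
        obtain ⟨_, h⟩ := blockMap_eq_some_iff.mp (Finset.mem_filter.mp hz).2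
        exact absurd (congrArg Sigma.fst h) hb
      have h1 : ∀ u : (H b).V, blockMap H b u = some ⟨b, v, hv⟩ ↔ u = v := by
        intro u
        rw [← (blockMap_injective b).eq_iff, (blockMap_eq_some_iff (v := v)).mpr ⟨hv, rfl⟩]
      have h2 : unionSide C (some ⟨b, v, hv⟩ : UnionVertex H) = (C b).side v := rfl
      have h5 := Finset.sum_eq_single b (fun b' _ hb => h0 b' hb)
        (fun h => absurd (Finset.mem_univ b) h)
      refine Eq.trans (by congr!) (h5.trans ?_)
      rw [h2]
      simp only [h1]
      have hcount : (Finset.univ.filter fun z : J b × ZMod (n b) =>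
          (C b).walk z.1 z.2 = v).card = p := by
        have := (C b).visits v
        rw [← Set.ncard_coe_finset]; simpa using this
      rw [Finset.sum_congr (g := fun _ => if (C b).side v = 0 then y else x) rfl,
        Finset.sum_const, hcount, smul_eq_mul, mul_ite]
      rintro ⟨j, i⟩ hz
      have hz' : (C b).walk j i = v := by simpa using hz
      have h3 := (C b).side_walk_eq_zero_iff j i
      rw [hz'] at h3
      by_cases hs : (C b).side v = 0
      · rw [if_pos hs]
        refine heven b j i ?_ (h3.mp hs)
        rintro rfl
        exact hv (hz' ▸ (C b).walk_zero j)
      · rw [if_neg hs]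
        refine hodd b j i ?_
        have := mt h3.mpr hs
        lia

end Union

/-- A decomposition into closed trails with another index set for the trails. -/
def CircuitCover.reindex {Γ : RootedGraph} {p n : ℕ} {J J' : Type} (C : CircuitCover Γ p J n)
    (e : J' ≃ J) : CircuitCover Γ p J' n where
  walk j i := C.walk (e j) i
  walk_zero j := C.walk_zero (e j)
  side := C.side
  side_root := C.side_root
  side_succ j i := C.side_succ (e j) i
  edge_bijOn := C.edge_bijOn.comp (e.prodCongr (Equiv.refl _)).bijective.bijOn_univ
  visits v := by
    refine Eq.trans ?_ (C.visits v)
    rw [← Nat.card_coe_set_eq, ← Nat.card_coe_set_eq]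
    exact Nat.card_congr ((e.prodCongr (Equiv.refl _)).subtypeEquiv fun _ => Iff.rfl)

/-! ### Circulant graphs as unions of Hamiltonian cycles -/

section Circulant

variable {m : ℕ} {S : Finset ℕ}

theorem circulant_adj {u v : ZMod m} : (circulant m S).graph.Adj u v ↔
    u ≠ v ∧ ((∃ a ∈ S, (a : ZMod m) = u - v) ∨ ∃ a ∈ S, (a : ZMod m) = v - u) := by
  simp [circulant, SimpleGraph.circulantGraph_adj]

theorem natCast_ne_zero_of_lt {a : ℕ} (h0 : 0 < a) (h : a < m) : (a : ZMod m) ≠ 0 := by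
  rw [Ne, ZMod.natCast_eq_zero_iff]
  exact fun hd => absurd (Nat.le_of_dvd h0 hd) (by lia)

theorem natCast_inj_of_lt {a b : ℕ} (ha : a < m) (hb : b < m) (h : (a : ZMod m) = b) : a = b := by
  rw [ZMod.natCast_eq_natCast_iff] at h
  exact Nat.ModEq.eq_of_lt_of_lt h ha hb

/-- Jumps below m/2 are pairwise distinct modulo m and no two of them, equal or not, add up to 0, so
each edge has one jump and one orientation. -/
theorem bijOn_circulant_edgeSet (hS : ∀ a ∈ S, 0 < a ∧ 2 * a < m) :
    Set.BijOn (fun x : S × ZMod m => (s(x.2, x.2 + (x.1 : ℕ)) : Sym2 (ZMod m))) Set.univ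
      (circulant m S).graph.edgeSet := by
  refine ⟨?_, ?_, ?_⟩
  · rintro ⟨⟨a, ha⟩, i⟩ -
    refine (SimpleGraph.mem_edgeSet _).mpr (circulant_adj.mpr ⟨?_, Or.inr ⟨a, ha, by ring⟩⟩)
    have := natCast_ne_zero_of_lt (hS a ha).1 (show a < m by have := hS a ha; lia)
    simpa using this
  · rintro ⟨⟨a, ha⟩, i⟩ - ⟨⟨b, hb⟩, j⟩ - h
    have ha' := hS a ha
    have hb' := hS b hb
    rcases Sym2.eq_iff.mp h with ⟨h1, h2⟩ | ⟨h1, h2⟩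
    · simp only at h1 h2
      rw [h1, add_right_inj] at h2
      have := natCast_inj_of_lt (by lia) (by lia) h2
      subst this; subst h1; rfl
    · simp only at h1 h2
      rw [h1, add_assoc, add_eq_left, ← Nat.cast_add] at h2
      exact absurd h2 (natCast_ne_zero_of_lt (by lia) (by lia))
  · intro e he
    induction e with
    | _ u v =>
    obtain ⟨-, ⟨a, ha, h⟩ | ⟨a, ha, h⟩⟩ := circulant_adj.mp ((SimpleGraph.mem_edgeSet _).mp he)
    · refine ⟨(⟨a, ha⟩, v), Set.mem_univ _, ?_⟩
      simp [h, Sym2.eq_swap]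
    · refine ⟨(⟨a, ha⟩, u), Set.mem_univ _, ?_⟩
      simp [h]

theorem ncard_mul_eq (hS : ∀ a ∈ S, IsUnit (a : ZMod m)) (v : ZMod m) :
    {x : S × ZMod m | ((x.1 : ℕ) : ZMod m) * x.2 = v}.ncard = S.card := by
  rw [← Set.ncard_coe_finset, ← Nat.card_coe_set_eq, ← Nat.card_coe_set_eq]
  refine Nat.card_congr ⟨fun x => x.1.1, fun a =>
    ⟨(a, ((hS a a.2).unit⁻¹ : (ZMod m)ˣ) * v), ?_⟩, ?_, ?_⟩
  · change ((a : ℕ) : ZMod m) * _ = v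
    rw [← mul_assoc, IsUnit.mul_val_inv, one_mul]
  · rintro ⟨⟨a, i⟩, rfl⟩
    refine Subtype.ext (Prod.ext rfl ?_)
    change _ * (_ * _) = _
    rw [← mul_assoc, IsUnit.val_inv_mul, one_mul]
  · intro a; rfl

/-- A circulant graph of even order whose jumps are coprime to the order is the union of the
Hamiltonian cycles that are generated by the jumps. -/
def circulantCover {p : ℕ} (hm : 2 ∣ m) (hS : IsJumpSet m p S) :
    CircuitCover (circulant m S) p S m :=
  have hpos : ∀ a ∈ S, 0 < a ∧ 2 * a < m := fun a ha => by
    obtain ⟨h1, h2⟩ := hS.2.2 a ha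
    refine ⟨Nat.pos_of_ne_zero ?_, h1⟩
    rintro rfl
    rw [Nat.coprime_zero_left] at h2
    lia
  have hunit : ∀ a ∈ S, IsUnit (a : ZMod m) := fun a ha =>
    (ZMod.isUnit_iff_coprime a m).mpr (hS.2.2 a ha).2
  { walk := fun a i => ((a : ℕ) : ZMod m) * i
    walk_zero := fun a => mul_zero ((a : ℕ) : ZMod m)
    side := ZMod.castHom hm (ZMod 2)
    side_root := map_zero (ZMod.castHom hm (ZMod 2))
    side_succ := by
      rintro ⟨a, ha⟩ i
      -- A jump coprime to the even order is odd, so each step changes the parity.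
      have h : ((a : ℕ) : ZMod 2) = 1 := by
        have h1 := (hS.2.2 a ha).2.coprime_dvd_right hm
        rw [Nat.coprime_two_right] at h1
        exact (ZMod.natCast_eq_one_iff_odd).mpr h1
      change ZMod.castHom hm (ZMod 2) (a * (i + 1)) = ZMod.castHom hm (ZMod 2) (a * i) + 1
      rw [mul_add, mul_one, map_add, map_natCast, h]
    edge_bijOn := by
      have h := bijOn_circulant_edgeSet hpos
      have h2 : Set.BijOn (fun x : S × ZMod m => (x.1, ((x.1 : ℕ) : ZMod m) * x.2))
          Set.univ Set.univ := by
        refine ⟨Set.mapsTo_univ _ _, ?_, ?_⟩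
        · rintro ⟨a, i⟩ - ⟨b, j⟩ - hab
          simp only [Prod.mk.injEq] at hab
          obtain ⟨rfl, h3⟩ := hab
          rw [(hunit a a.2).mul_right_inj] at h3
          rw [h3]
        · rintro ⟨a, i⟩ -
          obtain ⟨j, hj⟩ := (hunit a a.2).dvd (a := i)
          exact ⟨(a, j), Set.mem_univ _, by simp [hj]⟩
      refine (h.comp h2).congr fun x _ => ?_
      change (s(_, _) : Sym2 (ZMod m)) = s(_, _)
      simp only [mul_add, mul_one]
    visits := fun v => (ncard_mul_eq hunit v).trans hS.1 }

theorem isCirculant_circulant (hm : 1 ≤ m) : IsCirculant (circulant m S).graph :=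
  ⟨m, hm, _, ⟨SimpleGraph.Iso.refl⟩⟩

end Circulant

/-! ### Cycles with vertices merged in pairs -/

section MergedCycle

variable {n : ℕ} {P : Setoid (ZMod n)}

theorem bijOn_cycle_edgeSet (hn : 2 < n) :
    Set.BijOn (fun i : ZMod n => (s(i, i + 1) : Sym2 (ZMod n))) Set.univ
      (circulant n {1}).graph.edgeSet := by
  have h1 := bijOn_circulant_edgeSet (m := n) (S := {1}) (by simp; lia)
  have h2 : Set.BijOn (fun i : ZMod n => ((⟨1, by simp⟩ : ({1} : Finset ℕ)), i))
      Set.univ Set.univ := by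
    refine ⟨Set.mapsTo_univ _ _, ?_, ?_⟩
    · intro i _ j _ h; simpa using h
    · rintro ⟨⟨a, ha⟩, i⟩ -
      obtain rfl := Finset.mem_singleton.mp ha
      exact ⟨i, Set.mem_univ _, rfl⟩
  refine (h1.comp h2).congr fun i _ => ?_
  change (s(_, _) : Sym2 (ZMod n)) = s(_, _)
  simp only [Nat.cast_one]

/-- The cycle is traced in the graph that arises by merging its vertices in pairs. -/
def mergedCycleCover (hn2 : 2 ∣ n) (hn : 2 < n) (h1 : IsParityPairing n P)
    (h2 : MergesSimply n P) : CircuitCover (mergedCycle n P) 2 Unit n where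
  walk _ i := Quotient.mk P i
  walk_zero _ := rfl
  side := Quotient.lift (ZMod.castHom hn2 (ZMod 2)) fun a b hab => by
    have : NeZero n := ⟨by lia⟩
    have := h1.2 a b hab
    rw [← ZMod.natCast_zmod_val a, ← ZMod.natCast_zmod_val b, map_natCast, map_natCast,
      ZMod.natCast_eq_natCast_iff]
    exact this
  side_root := map_zero (ZMod.castHom hn2 (ZMod 2))
  side_succ _ i := by
    change ZMod.castHom hn2 (ZMod 2) (i + 1) = ZMod.castHom hn2 (ZMod 2) i + 1
    rw [map_add, map_one]
  edge_bijOn := by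
    have hb : Set.BijOn (fun x : Unit × ZMod n => x.2) Set.univ Set.univ :=
      ⟨Set.mapsTo_univ _ _, fun x _ y _ h => Prod.ext rfl h, fun i _ => ⟨((), i), trivial, rfl⟩⟩
    have h5 : Set.BijOn (Sym2.map (Quotient.mk P)) (circulant n {1}).graph.edgeSet
        (mergedCycle n P).graph.edgeSet := by
      refine ⟨fun e he => ?_, h2.2, fun e he => ?_⟩
      · induction e with
        | _ u v =>
        exact (SimpleGraph.map_adj' _ _ _ _).mpr ⟨fun h => h2.1 u v he (Quotient.exact h),
          u, v, he, rfl, rfl⟩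
      · induction e with
        | _ u v =>
        obtain ⟨-, u', v', h, rfl, rfl⟩ := (SimpleGraph.map_adj' _ _ _ _).mp he
        exact ⟨s(u', v'), h, rfl⟩
    exact h5.comp ((bijOn_cycle_edgeSet hn).comp hb)
  visits v := by
    induction v using Quotient.inductionOn with
    | _ a =>
    rw [← h1.1 a, ← Nat.card_coe_set_eq, ← Nat.card_coe_set_eq]
    refine Nat.card_congr ((Equiv.punitProd (ZMod n)).subtypeEquiv ?_)
    rintro ⟨_, i⟩
    exact ⟨fun h => P.symm (Quotient.exact h), fun h => Quotient.sound (P.symm h)⟩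

end MergedCycle

/-! ### An Euler circuit given by mixed-radix digits -/

section EulerCircuit

/-- The vertices of an Euler circuit of the graph in which the integers modulo `M * p` are adjacent
if they differ by `1` or `-1` modulo `M`. -/
def eulerWalk (M p I : ℕ) : ℕ :=
  I % M + M * (if I % 2 = 0 then I / M / p else I / M % p)

variable {M p : ℕ}

/-- View a vertex as a column r modulo M and a level below p. The circuit goes round the columns
once for every pair of levels (a, b), with level a in the even columns and b in the odd ones; so
between consecutive columns each pair of levels is used once. -/
theorem eulerWalk_eq (hM : 2 ∣ M) {a b r : ℕ} (hb : b < p) (hr : r < M) :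
    eulerWalk M p (M * (p * a + b) + r) = r + M * (if r % 2 = 0 then a else b) := by
  have h1 : (M * (p * a + b) + r) % M = r := by rw [Nat.mul_add_mod, Nat.mod_eq_of_lt hr]
  have h2 : (M * (p * a + b) + r) / M = p * a + b := by
    rw [Nat.mul_add_div (by lia), Nat.div_eq_of_lt hr, add_zero]
  have h3 : (p * a + b) / p = a := by
    rw [Nat.mul_add_div (by lia), Nat.div_eq_of_lt hb, add_zero]
  have h4 : (p * a + b) % p = b := by rw [Nat.mul_add_mod, Nat.mod_eq_of_lt hb]
  have h5 : (M * (p * a + b) + r) % 2 = r % 2 := by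
    obtain ⟨k, rfl⟩ := hM
    rw [mul_assoc, Nat.mul_add_mod]
  rw [eulerWalk, h1, h2, h3, h4, h5]

theorem exists_digits (I : ℕ) (hM : 0 < M) (hp : 0 < p) :
    ∃ a b r, b < p ∧ r < M ∧ I = M * (p * a + b) + r :=
  ⟨I / M / p, I / M % p, I % M, Nat.mod_lt _ hp, Nat.mod_lt _ hM, by
    rw [Nat.div_add_mod, Nat.div_add_mod]⟩

theorem digit_lt {a b r : ℕ} (h : M * (p * a + b) + r < M * (p * p)) : a < p := by
  by_contra! h1
  have := Nat.mul_le_mul_left M ((Nat.mul_le_mul_left p h1).trans (Nat.le_add_right _ b))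
  lia

theorem eulerWalk_mod (I : ℕ) : eulerWalk M p I % M = I % M := by
  rw [eulerWalk, Nat.add_mul_mod_self_left, Nat.mod_mod]

theorem eulerWalk_period (hM : 2 ∣ M) (hM0 : 0 < M) (hp : 0 < p) :
    ((eulerWalk M p (M * (p * p)) : ℕ) : ZMod (M * p)) = eulerWalk M p 0 := by
  have h1 := eulerWalk_eq hM (a := p) hp hM0
  have h2 := eulerWalk_eq hM (a := 0) hp hM0
  simp only [add_zero, mul_zero, Nat.zero_mod, if_true, zero_add] at h1 h2
  rw [h1, h2, ZMod.natCast_self, Nat.cast_zero]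

theorem add_mul_inj {r r' a a' : ℕ} (hr : r < M) (ha : a < p) (hr' : r' < M) (ha' : a' < p)
    (h : ((r + M * a : ℕ) : ZMod (M * p)) = (r' + M * a' : ℕ)) : r = r' ∧ a = a' := by
  have hlt : ∀ {r a : ℕ}, r < M → a < p → r + M * a < M * p := fun {r a} hr ha => by
    have := Nat.mul_le_mul_left M (show a + 1 ≤ p from ha)
    rw [mul_add] at this
    lia
  have h1 := natCast_inj_of_lt (hlt hr ha) (hlt hr' ha') h
  have h2 := congrArg (· % M) h1
  simp only [Nat.add_mul_mod_self_left, Nat.mod_eq_of_lt hr, Nat.mod_eq_of_lt hr'] at h2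
  subst h2
  exact ⟨rfl, Nat.eq_of_mul_eq_mul_left (by lia) (Nat.add_left_cancel h1)⟩

/-- Two consecutive vertices of the Euler circuit determine the position. -/
theorem eulerWalk_injective (hM : 2 ∣ M) (hM0 : 0 < M) (hp : 0 < p) {I I' : ℕ}
    (hI : I < M * (p * p)) (hI' : I' < M * (p * p))
    (h1 : ((eulerWalk M p I : ℕ) : ZMod (M * p)) = eulerWalk M p I')
    (h2 : ((eulerWalk M p (I + 1) : ℕ) : ZMod (M * p)) = eulerWalk M p (I' + 1)) : I = I' := by
  obtain ⟨a, b, r, hb, hr, rfl⟩ := exists_digits I hM0 hp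
  obtain ⟨a', b', r', hb', hr', rfl⟩ := exists_digits I' hM0 hp
  have ha := digit_lt hI
  have ha' := digit_lt hI'
  rw [eulerWalk_eq hM hb hr, eulerWalk_eq hM hb' hr'] at h1
  obtain ⟨rfl, h1⟩ := add_mul_inj hr (by split_ifs <;> assumption) hr'
    (by split_ifs <;> assumption) h1
  rw [add_assoc, add_assoc] at h2
  by_cases hr1 : r + 1 < M
  · rw [eulerWalk_eq hM hb hr1, eulerWalk_eq hM hb' hr1] at h2
    obtain ⟨-, h2⟩ := add_mul_inj hr1 (by split_ifs <;> assumption) hr1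
      (by split_ifs <;> assumption) h2
    rcases Nat.mod_two_eq_zero_or_one r with h0 | h0
    · rw [if_pos h0, if_pos h0] at h1
      rw [if_neg (by lia), if_neg (by lia)] at h2
      rw [h1, h2]
    · rw [if_neg (by lia), if_neg (by lia)] at h1
      rw [if_pos (by lia), if_pos (by lia)] at h2
      rw [h1, h2]
  · have hr2 : r + 1 = M := by lia
    rw [if_neg (by lia), if_neg (by lia)] at h1
    subst h1
    -- The step from the last column back to column 0 moves to the next pair of levels: a stays
    -- unless b is the last level, in which case it increases by one.
    have hnext : ∀ a, eulerWalk M p (M * (p * a + b) + (r + 1)) =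
        M * (if b + 1 < p then a else a + 1) := by
      intro a
      rw [hr2]
      by_cases hbp : b + 1 < p
      · have := eulerWalk_eq hM (a := a) hbp hM0
        rw [if_pos hbp]
        rw [← add_assoc, mul_add M _ 1] at this
        simpa using this
      · have hbp' : b + 1 = p := by lia
        have := eulerWalk_eq hM (a := a + 1) hp hM0
        rw [if_neg hbp, show M * (p * a + b) + M = M * (p * (a + 1) + 0) + 0 by
          rw [← hbp']; ring, this]
        simp
    rw [hnext, hnext] at h2
    by_cases hbp : b + 1 < p
    · rw [if_pos hbp, if_pos hbp] at h2
      have := (add_mul_inj hM0 ha hM0 ha' (by simpa using h2)).2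
      rw [this]
    · rw [if_neg hbp, if_neg hbp] at h2
      -- Both levels were raised by one; the common shift cancels modulo M * p, also where the level
      -- wraps round to 0.
      have h3 : ((0 + M * a : ℕ) : ZMod (M * p)) = (0 + M * a' : ℕ) := by
        push_cast at h2 ⊢
        linear_combination h2
      rw [(add_mul_inj hM0 ha hM0 ha' h3).2]

theorem val_succ_comp {n : ℕ} [NeZero n] {α : Type} {f : ℕ → α} (h : f n = f 0) (i : ZMod n) :
    f (i + 1).val = f (i.val + 1) := by
  have hi := ZMod.val_lt i
  have h1 : (i + 1).val = (i.val + 1) % n := by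
    rw [← ZMod.val_natCast, Nat.cast_succ, ZMod.natCast_zmod_val]
  rcases Nat.lt_or_ge (i.val + 1) n with h2 | h2
  · rw [h1, Nat.mod_eq_of_lt h2]
  · have h3 : i.val + 1 = n := by lia
    rw [h1, h3, Nat.mod_self, h]

/-- A vertex fixes its column and one of the two digits, a in an even column and b in an odd one;
the other digit is free and gives p positions. -/
theorem ncard_eulerWalk_eq (hM : 2 ∣ M) (hM0 : 0 < M) (hp : 0 < p) (v : ZMod (M * p)) :
    {x : Unit × ZMod (M * (p * p)) | ((eulerWalk M p x.2.val : ℕ) : ZMod (M * p)) = v}.ncard =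
      p := by
  have : NeZero (M * p) := ⟨by positivity⟩
  have : NeZero (M * (p * p)) := ⟨by positivity⟩
  obtain ⟨r, x, hr, hx, rfl⟩ : ∃ r x, r < M ∧ x < p ∧ ((r + M * x : ℕ) : ZMod (M * p)) = v :=
    ⟨v.val % M, v.val / M, Nat.mod_lt _ hM0, Nat.div_lt_of_lt_mul (ZMod.val_lt v), by
      rw [Nat.mod_add_div, ZMod.natCast_zmod_val]⟩
  set pos : ℕ → ℕ := fun y => if r % 2 = 0 then M * (p * x + y) + r else M * (p * y + x) + r
    with hpos
  have hlt : ∀ a b, a < p → b < p → M * (p * a + b) + r < M * (p * p) := by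
    intro a b ha hb
    have h1 := Nat.mul_le_mul_left p (show a + 1 ≤ p from ha)
    have h2 := Nat.mul_le_mul_left M (show p * a + b + 1 ≤ p * p by rw [mul_add] at h1; lia)
    rw [mul_add M _ 1] at h2
    lia
  have hposlt : ∀ y, y < p → pos y < M * (p * p) := by
    intro y hy
    simp only [hpos]
    split_ifs
    · exact hlt _ _ hx hy
    · exact hlt _ _ hy hx
  have hval : ∀ y, y < p → ((pos y : ℕ) : ZMod (M * (p * p))).val = pos y := fun y hy => by
    rw [ZMod.val_natCast, Nat.mod_eq_of_lt (hposlt y hy)]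
  have hposinj : ∀ y y', pos y = pos y' → y = y' := by
    intro y y' h
    simp only [hpos] at h
    split_ifs at h
    · have := Nat.eq_of_mul_eq_mul_left hM0 (Nat.add_right_cancel h)
      lia
    · have := Nat.eq_of_mul_eq_mul_left hM0 (Nat.add_right_cancel h)
      exact Nat.eq_of_mul_eq_mul_left hp (Nat.add_right_cancel this)
  have hset : {z : Unit × ZMod (M * (p * p)) |
      ((eulerWalk M p z.2.val : ℕ) : ZMod (M * p)) = (r + M * x : ℕ)} =
      (fun y => ((), ((pos y : ℕ) : ZMod (M * (p * p))))) '' (Finset.range p : Set ℕ) := by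
    ext ⟨u, i⟩
    simp only [Set.mem_ofPred_eq, Set.mem_image, Finset.coe_range, Set.mem_Iio, Prod.mk.injEq]
    constructor
    · intro h
      obtain ⟨a, b, r', hb, hr', hi⟩ := exists_digits i.val hM0 hp
      have ha := digit_lt (hi ▸ ZMod.val_lt i)
      rw [hi, eulerWalk_eq hM hb hr'] at h
      obtain ⟨hrr, hx2⟩ := add_mul_inj hr' (by split_ifs <;> assumption) hr hx h
      rw [hrr] at hi hx2
      by_cases h0 : r % 2 = 0
      · rw [if_pos h0] at hx2
        refine ⟨b, hb, trivial, ?_⟩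
        simp only [hpos]
        rw [if_pos h0, ← hx2, ← hi, ZMod.natCast_zmod_val]
      · rw [if_neg h0] at hx2
        refine ⟨a, ha, trivial, ?_⟩
        simp only [hpos]
        rw [if_neg h0, ← hx2, ← hi, ZMod.natCast_zmod_val]
    · rintro ⟨y, hy, -, rfl⟩
      rw [hval y hy]
      simp only [hpos]
      split_ifs with h0
      · rw [eulerWalk_eq hM hy hr, if_pos h0]
      · rw [eulerWalk_eq hM hx hr, if_neg h0]
  rw [hset, Set.InjOn.ncard_image, Set.ncard_coe_finset, Finset.card_range]
  intro y hy y' hy' h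
  simp only [Finset.coe_range, Set.mem_Iio, Prod.mk.injEq, true_and] at hy hy' h
  exact hposinj _ _ (natCast_inj_of_lt (hposlt y hy) (hposlt y' hy') h)

end EulerCircuit

/-! ### The circulant graph with jumps congruent to 1 or -1 -/

section Jumps

variable {s t : ℕ}

theorem two_pow_eq (hs : 2 ≤ s) : 2 ^ (s - 1) = 2 * 2 ^ (s - 2) ∧ 2 ^ s = 2 * 2 ^ (s - 1) := by
  obtain ⟨u, rfl⟩ := Nat.exists_eq_add_of_le hs
  constructor
  · rw [show 2 + u - 1 = u + 1 by lia, show 2 + u - 2 = u by lia, pow_succ']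
  · rw [show 2 + u = u + 1 + 1 by lia, show u + 1 + 1 - 1 = u + 1 by lia, pow_succ']

theorem mem_jumps {a : ℕ} : a ∈ jumps s t ↔
    ∃ l < 2 ^ (s - 2), a = 1 + l * (2 * t + 4) ∨ a = 2 * t + 3 + l * (2 * t + 4) := by
  simp only [jumps, Finset.mem_union, Finset.mem_image, Finset.mem_range]
  constructor
  · rintro (⟨l, hl, rfl⟩ | ⟨l, hl, rfl⟩)
    · exact ⟨l, hl, Or.inl rfl⟩
    · exact ⟨l, hl, Or.inr rfl⟩
  · rintro ⟨l, hl, rfl | rfl⟩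
    · exact Or.inl ⟨l, hl, rfl⟩
    · exact Or.inr ⟨l, hl, rfl⟩

theorem card_jumps (hs : 2 ≤ s) : (jumps s t).card = 2 ^ (s - 1) := by
  rw [jumps, Finset.card_union_of_disjoint, Finset.card_image_of_injective,
    Finset.card_image_of_injective, Finset.card_range, (two_pow_eq hs).1]
  · ring
  · intro a b h
    exact Nat.eq_of_mul_eq_mul_right (by lia) (Nat.add_left_cancel h)
  · intro a b h
    exact Nat.eq_of_mul_eq_mul_right (by lia) (Nat.add_left_cancel h)
  · rw [Finset.disjoint_left]
    intro a h1 h2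
    simp only [Finset.mem_image, Finset.mem_range] at h1 h2
    obtain ⟨l, -, rfl⟩ := h1
    obtain ⟨l', -, h⟩ := h2
    have := congrArg (· % (2 * t + 4)) h
    simp only [Nat.add_mul_mod_self_right] at this
    rw [Nat.mod_eq_of_lt (by lia), Nat.mod_eq_of_lt (by lia)] at this
    lia

theorem jumps_lt (hs : 2 ≤ s) {a : ℕ} (ha : a ∈ jumps s t) :
    0 < a ∧ 2 * a < (2 * t + 4) * 2 ^ (s - 1) := by
  obtain ⟨l, hl, h⟩ := mem_jumps.mp ha
  have h1 := Nat.mul_le_mul_right (2 * t + 4) (show l + 1 ≤ 2 ^ (s - 2) from hl)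
  rw [(two_pow_eq hs).1, show (2 * t + 4) * (2 * 2 ^ (s - 2)) =
    2 * (2 ^ (s - 2) * (2 * t + 4)) by ring]
  rw [add_mul] at h1
  rcases h with rfl | rfl <;> lia

/-- The jumps represent every difference congruent to 1 modulo M up to sign: the difference is 1 +
M*l with l < 2^(s-1), and for l in the upper half its negative is M-1 + (2^(s-1)-1-l)*M, a jump of
the second kind. -/
theorem circulant_jumps_adj (hs : 2 ≤ s) {M : ℕ} (hM : M = 2 * t + 4)
    {u v : ZMod (M * 2 ^ (s - 1))}
    (h : ZMod.castHom (Dvd.intro _ rfl) (ZMod M) (v - u) = 1) :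
    (circulant (M * 2 ^ (s - 1)) (jumps s t)).graph.Adj u v := by
  have : NeZero (M * 2 ^ (s - 1)) := ⟨by rw [hM]; positivity⟩
  have : Fact (1 < M) := ⟨by lia⟩
  refine circulant_adj.mpr ⟨?_, ?_⟩
  · rintro rfl
    rw [sub_self, map_zero] at h
    exact zero_ne_one h
  · set d := v - u with hd
    have hdv : ((d.val : ℕ) : ZMod M) = ((1 : ℕ) : ZMod M) := by
      rw [← map_natCast (ZMod.castHom (Dvd.intro _ rfl : M ∣ M * 2 ^ (s - 1)) (ZMod M)),
        ZMod.natCast_zmod_val, h, Nat.cast_one]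
    rw [ZMod.natCast_eq_natCast_iff', Nat.mod_eq_of_lt (show 1 < M by lia)] at hdv
    have hlt : d.val / M < 2 ^ (s - 1) := Nat.div_lt_of_lt_mul (ZMod.val_lt d)
    have hdm := Nat.mod_add_div d.val M
    rw [hdv] at hdm
    set l := d.val / M
    have hp := (two_pow_eq hs).1
    rcases Nat.lt_or_ge l (2 ^ (s - 2)) with hl | hl
    · refine Or.inr ⟨d.val, mem_jumps.mpr ⟨l, hl, Or.inl ?_⟩, ZMod.natCast_zmod_val d⟩
      rw [← hdm, ← hM, mul_comm]
    · refine Or.inl ⟨_, mem_jumps.mpr ⟨2 ^ (s - 1) - 1 - l, by lia, Or.inr rfl⟩, ?_⟩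
      obtain ⟨k, hk⟩ := Nat.exists_eq_add_of_lt hlt
      have h1 : 2 * t + 3 + (2 ^ (s - 1) - 1 - l) * M + d.val = M * 2 ^ (s - 1) := by
        rw [← hdm, show 2 ^ (s - 1) - 1 - l = k by lia, hk,
          show 2 * t + 3 = M - 1 by lia]
        have : M - 1 + 1 = M := by lia
        calc M - 1 + k * M + (1 + M * l) = (M - 1 + 1) + k * M + M * l := by ring
          _ = M * (l + k + 1) := by rw [this]; ring
      have h2 := congrArg (Nat.cast (R := ZMod (M * 2 ^ (s - 1)))) h1
      rw [Nat.cast_add, ZMod.natCast_zmod_val, ZMod.natCast_self] at h2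
      rw [← hM, show u - v = -d by rw [hd]; ring]
      exact eq_neg_of_add_eq_zero_left h2

/-- The Euler circuit of the circulant graph with jump set `jumps s t`. -/
def jumpsCover (hs : 2 ≤ s) :
    CircuitCover (circulant ((2 * t + 4) * 2 ^ (s - 1)) (jumps s t)) (2 ^ (s - 1)) Unit
      ((2 * t + 4) * (2 ^ (s - 1) * 2 ^ (s - 1))) :=
  have hM : 2 ∣ 2 * t + 4 := ⟨t + 2, by ring⟩
  have hM0 : 0 < 2 * t + 4 := by lia
  have hp : 0 < 2 ^ (s - 1) := by positivity
  have : NeZero ((2 * t + 4) * (2 ^ (s - 1) * 2 ^ (s - 1))) := ⟨by positivity⟩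
  have : NeZero ((2 * t + 4) * 2 ^ (s - 1)) := ⟨by positivity⟩
  have hd : 2 * t + 4 ∣ (2 * t + 4) * 2 ^ (s - 1) := Dvd.intro _ rfl
  have hsucc : ∀ i : ZMod ((2 * t + 4) * (2 ^ (s - 1) * 2 ^ (s - 1))),
      ((eulerWalk (2 * t + 4) (2 ^ (s - 1)) (i + 1).val : ℕ) :
        ZMod ((2 * t + 4) * 2 ^ (s - 1))) =
      (eulerWalk (2 * t + 4) (2 ^ (s - 1)) (i.val + 1) : ℕ) := fun i =>
    val_succ_comp (f := fun I => ((eulerWalk (2 * t + 4) (2 ^ (s - 1)) I : ℕ) :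
        ZMod ((2 * t + 4) * 2 ^ (s - 1)))) (eulerWalk_period hM hM0 hp) i
  have hcast : ∀ I : ℕ, ((eulerWalk (2 * t + 4) (2 ^ (s - 1)) I : ℕ) : ZMod (2 * t + 4)) = I :=
    fun I => by
      rw [ZMod.natCast_eq_natCast_iff']; exact eulerWalk_mod I
  have hside : ∀ I : ℕ, ((eulerWalk (2 * t + 4) (2 ^ (s - 1)) I : ℕ) : ZMod 2) = I := fun I => by
    have := congrArg (ZMod.castHom hM (ZMod 2)) (hcast I)
    rwa [map_natCast, map_natCast] at this
  { walk := fun _ i => ((eulerWalk (2 * t + 4) (2 ^ (s - 1)) i.val : ℕ) :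
      ZMod ((2 * t + 4) * 2 ^ (s - 1)))
    walk_zero := fun _ => by
      rw [ZMod.val_zero]
      simp [eulerWalk, circulant]
    side := ZMod.castHom (hM.trans hd) (ZMod 2)
    side_root := map_zero (ZMod.castHom (hM.trans hd) (ZMod 2))
    side_succ := by
      intro _ i
      rw [hsucc]
      rw [map_natCast, map_natCast, hside, hside, Nat.cast_succ]
    edge_bijOn := by
      have hmaps : Set.MapsTo (fun x : Unit × ZMod ((2 * t + 4) * (2 ^ (s - 1) * 2 ^ (s - 1))) =>
          (s(((eulerWalk (2 * t + 4) (2 ^ (s - 1)) x.2.val : ℕ) :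
            ZMod ((2 * t + 4) * 2 ^ (s - 1))),
            ((eulerWalk (2 * t + 4) (2 ^ (s - 1)) (x.2 + 1).val : ℕ) :
            ZMod ((2 * t + 4) * 2 ^ (s - 1)))) : Sym2 (ZMod ((2 * t + 4) * 2 ^ (s - 1)))))
          Set.univ (circulant ((2 * t + 4) * 2 ^ (s - 1)) (jumps s t)).graph.edgeSet := by
        rintro ⟨_, i⟩ -
        refine (SimpleGraph.mem_edgeSet _).mpr (circulant_jumps_adj hs rfl ?_)
        rw [hsucc, map_sub, map_natCast, map_natCast, hcast, hcast, Nat.cast_succ]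
        ring
      have hinj : Set.InjOn (fun x : Unit × ZMod ((2 * t + 4) * (2 ^ (s - 1) * 2 ^ (s - 1))) =>
          (s(((eulerWalk (2 * t + 4) (2 ^ (s - 1)) x.2.val : ℕ) :
            ZMod ((2 * t + 4) * 2 ^ (s - 1))),
            ((eulerWalk (2 * t + 4) (2 ^ (s - 1)) (x.2 + 1).val : ℕ) :
            ZMod ((2 * t + 4) * 2 ^ (s - 1)))) : Sym2 (ZMod ((2 * t + 4) * 2 ^ (s - 1)))))
          Set.univ := by
        rintro ⟨_, i⟩ - ⟨_, j⟩ - h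
        simp only [hsucc] at h
        rcases Sym2.eq_iff.mp h with ⟨h1, h2⟩ | ⟨h1, h2⟩
        · have := eulerWalk_injective hM hM0 hp (ZMod.val_lt i) (ZMod.val_lt j) h1 h2
          rw [ZMod.val_injective _ this]
        · have h3 := congrArg (ZMod.castHom hd (ZMod (2 * t + 4))) h1
          have h4 := congrArg (ZMod.castHom hd (ZMod (2 * t + 4))) h2
          rw [map_natCast, map_natCast, hcast, hcast, Nat.cast_succ] at h3 h4
          -- The circuit always advances one column, so traversing an edge in both directions would
          -- force 2 = 0 modulo 2t+4.
          have h5 : ((2 : ℕ) : ZMod (2 * t + 4)) = 0 := by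
            rw [h3] at h4
            push_cast
            linear_combination h4
          exact absurd h5 (natCast_ne_zero_of_lt (by lia) (by lia))
      have hE := (bijOn_circulant_edgeSet (fun a ha => jumps_lt (t := t) hs ha)).image_eq
      have hfin : (circulant ((2 * t + 4) * 2 ^ (s - 1)) (jumps s t)).graph.edgeSet.Finite :=
        hE ▸ (Set.toFinite _).image _
      have hcard : (circulant ((2 * t + 4) * 2 ^ (s - 1)) (jumps s t)).graph.edgeSet.ncard =
          (2 * t + 4) * (2 ^ (s - 1) * 2 ^ (s - 1)) := by
        refine (congrArg Set.ncard hE.symm).trans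
          ((bijOn_circulant_edgeSet fun a ha => jumps_lt hs ha).injOn.ncard_image.trans ?_)
        rw [Set.ncard_univ, Nat.card_prod, Nat.card_zmod, Nat.card_eq_fintype_card,
          Fintype.card_coe, card_jumps hs]
        ring
      -- The positions map injectively to edges and are as many as the edges, so every edge is used.
      have himg := Set.eq_of_subset_of_ncard_le hmaps.image_subset
        (hcard.le.trans (hinj.ncard_image.trans (by
          rw [Set.ncard_univ, Nat.card_prod, Nat.card_zmod]; simp)).ge) hfin
      exact ⟨hmaps, hinj, himg.ge⟩
    visits := fun v => ncard_eulerWalk_eq hM hM0 hp v }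

end Jumps

/-! ### Labels along the trails -/

/-- The label at position `I` of a closed trail of length `2 * k` whose labels are, in turn,
`a`, `c + (k - 1) * d`, `a + d`, `c + (k - 2) * d`, …, `a + (k - 1) * d`, `c`. -/
def trailLabel (d a c k I : ℕ) : ℕ :=
  if I % 2 = 0 then a + I / 2 * d else c + (k - 1 - I / 2) * d

/-- A system of closed trails with starting labels `a ∈ A`, on which `trailLabel` uses each of the
labels `1, …, x - 1` once, such that the labels at the starting point have the sum `x + d`. -/
structure LabelScheme (A : Finset ℕ) (d x : ℕ) (c k : ℕ → ℕ) : Prop where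
  pos : 0 < d
  sum_eq : ∀ a ∈ A, 1 ≤ a ∧ 1 ≤ c a ∧ 1 ≤ k a ∧ a + c a + (k a - 1) * d = x
  inj : ∀ a ∈ A, ∀ a' ∈ A, ∀ I < 2 * k a, ∀ I' < 2 * k a',
    trailLabel d a (c a) (k a) I = trailLabel d a' (c a') (k a') I' → a = a' ∧ I = I'
  start : ∑ a ∈ A, (a + c a) = x + d
  count : ∑ a ∈ A, 2 * k a + 1 = x

section TrailLabel

variable {d a c k x I : ℕ}

theorem trailLabel_mem (ha : 1 ≤ a) (hc : 1 ≤ c) (h : a + c + (k - 1) * d = x)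
    (hI : I < 2 * k) : 1 ≤ trailLabel d a c k I ∧ trailLabel d a c k I < x := by
  have h1 := Nat.mul_le_mul_right d (show I / 2 ≤ k - 1 by lia)
  have h2 := Nat.mul_le_mul_right d (show k - 1 - I / 2 ≤ k - 1 by lia)
  unfold trailLabel
  split_ifs <;> constructor <;> lia

theorem trailLabel_odd (h : a + c + (k - 1) * d = x) (hI : I < 2 * k) (h1 : I % 2 = 1) :
    trailLabel d a c k I + trailLabel d a c k (I - 1) = x := by
  rw [trailLabel, trailLabel, if_neg (by lia), if_pos (by lia), show (I - 1) / 2 = I / 2 by lia,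
    ← h]
  obtain ⟨v, hv⟩ := Nat.exists_eq_add_of_le (show I / 2 ≤ k - 1 by lia)
  rw [hv, Nat.add_sub_cancel_left]
  ring

theorem trailLabel_even (h : a + c + (k - 1) * d = x) (hI : I < 2 * k) (h0 : I ≠ 0)
    (h1 : I % 2 = 0) : trailLabel d a c k I + trailLabel d a c k (I - 1) = x + d := by
  rw [trailLabel, trailLabel, if_pos h1, if_neg (by lia), ← h]
  obtain ⟨v, hv⟩ := Nat.exists_eq_add_of_le (show (I - 1) / 2 ≤ k - 1 by lia)
  rw [hv, Nat.add_sub_cancel_left, show I / 2 = (I - 1) / 2 + 1 by lia]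
  ring

theorem trailLabel_start (hk : 1 ≤ k) :
    trailLabel d a c k 0 + trailLabel d a c k (2 * k - 1) = a + c := by
  rw [trailLabel, trailLabel, if_pos (by lia), if_neg (by lia),
    show k - 1 - (2 * k - 1) / 2 = 0 by lia]
  simp

end TrailLabel

theorem val_sub_one {n : ℕ} [NeZero n] {i : ZMod n} (hi : i ≠ 0) : (i - 1).val = i.val - 1 := by
  have h0 : i.val ≠ 0 := by rwa [Ne, ZMod.val_eq_zero]
  have h1 : i - 1 = ((i.val - 1 : ℕ) : ZMod n) := by
    rw [Nat.cast_sub (by lia), ZMod.natCast_zmod_val, Nat.cast_one]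
  have := ZMod.val_lt i
  rw [h1, ZMod.val_natCast, Nat.mod_eq_of_lt (by lia)]

theorem val_zero_sub_one {n : ℕ} [NeZero n] : (0 - 1 : ZMod n).val = n - 1 := by
  have h0 := NeZero.pos n
  have h1 : (0 - 1 : ZMod n) = ((n - 1 : ℕ) : ZMod n) := by
    rw [Nat.cast_sub h0, ZMod.natCast_self, Nat.cast_one]
  rw [h1, ZMod.val_natCast, Nat.mod_eq_of_lt (by lia)]

/-! ### From a label scheme to the one-point union -/

section Blocks

variable {B : Type} {H : B → RootedGraph} {p : ℕ} {J : B → Type} {n : B → ℕ}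

/-- The map `a` gives each trail its starting label; being injective into a set of the right size,
it turns sums over A into sums over the trails. The edge count is kept for telling graphs apart
later. -/
theorem hasChiLaTwo_of_labelScheme [Fintype B] [Nonempty B] [∀ b, Fintype (J b)]
    [∀ b, Nonempty (J b)] [∀ b, NeZero (n b)] (C : ∀ b, CircuitCover (H b) p (J b) (n b))
    (hp : 1 ≤ p) {A : Finset ℕ} {d x : ℕ} {c k : ℕ → ℕ} (hs : LabelScheme A d x c k)
    {a : (Σ b, J b) → ℕ} (hinj : Function.Injective a) (hmem : ∀ t, a t ∈ A)
    (hn : ∀ b j, n b = 2 * k (a ⟨b, j⟩)) (hA : A.card = Fintype.card (Σ b, J b))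
    (hcard : Fintype.card B * p + 1 = p + A.card) :
    HasChiLaTwo (onePointUnion H) ∧ (onePointUnion H).graph.edgeSet.ncard + 1 = x := by
  have himg : Finset.univ.image a = A := by
    refine Finset.eq_of_subset_of_card_le ?_ ?_
    · intro y hy
      obtain ⟨t, -, rfl⟩ := Finset.mem_image.mp hy
      exact hmem t
    · rw [Finset.card_image_of_injective _ hinj, hA]; rfl
  have hsum : ∀ f : ℕ → ℕ, ∑ b, ∑ j, f (a ⟨b, j⟩) = ∑ y ∈ A, f y := by
    intro f
    rw [← himg, Finset.sum_image hinj.injOn, Fintype.sum_sigma]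
  have hcount : Fintype.card (Σ b, J b × ZMod (n b)) + 1 = x := by
    rw [← hs.count, ← hsum fun y => 2 * k y, Fintype.card_sigma]
    congr 1
    refine Finset.sum_congr rfl fun b _ => ?_
    rw [Finset.sum_congr rfl fun j _ => (hn b j).symm, Fintype.card_prod, ZMod.card]
    simp
  set l : (Σ b, J b × ZMod (n b)) → ℕ := fun z =>
    trailLabel d (a ⟨z.1, z.2.1⟩) (c (a ⟨z.1, z.2.1⟩)) (k (a ⟨z.1, z.2.1⟩)) z.2.2.val with hl
  have hlt : ∀ b j (i : ZMod (n b)), i.val < 2 * k (a ⟨b, j⟩) := fun b j i =>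
    hn b j ▸ ZMod.val_lt i
  refine ⟨⟨finite_onePointUnion C hp, connected_onePointUnion C hp, ?_⟩, by
    rw [ncard_edgeSet_onePointUnion C, Nat.card_eq_fintype_card, hcount]⟩
  refine
    chiLa_onePointUnion C hp (l := l) (x := x) (y := x + d) ?_ ?_ (by have := hs.pos; lia)
      ?_ ?_ ?_ ?_
  · rintro ⟨b, j, i⟩ ⟨b', j', i'⟩ h
    obtain ⟨h1, h2⟩ := hs.inj _ (hmem ⟨b, j⟩) _ (hmem ⟨b', j'⟩) _ (hlt b j i) _ (hlt b' j' i') h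
    cases hinj h1
    rw [ZMod.val_injective _ h2]
  · rintro ⟨b, j, i⟩
    obtain ⟨h1, h2, -, h3⟩ := hs.sum_eq _ (hmem ⟨b, j⟩)
    have := trailLabel_mem h1 h2 h3 (hlt b j i)
    exact ⟨this.1, by rw [hl]; lia⟩
  · intro b j i hi
    obtain ⟨h1, h2, -, h3⟩ := hs.sum_eq _ (hmem ⟨b, j⟩)
    have h0 : i ≠ 0 := by rintro rfl; simp at hi
    have := trailLabel_odd h3 (hlt b j i) hi
    rwa [← val_sub_one h0] at this
  · intro b j i h0 hi
    obtain ⟨h1, h2, -, h3⟩ := hs.sum_eq _ (hmem ⟨b, j⟩)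
    have := trailLabel_even h3 (hlt b j i) (by rwa [Ne, ZMod.val_eq_zero]) hi
    rwa [← val_sub_one h0] at this
  · rw [← hs.start, ← hsum fun y => y + c y]
    refine Finset.sum_congr rfl fun b _ => Finset.sum_congr rfl fun j _ => ?_
    obtain ⟨-, -, h3, -⟩ := hs.sum_eq _ (hmem ⟨b, j⟩)
    have := trailLabel_start (d := d) (a := a ⟨b, j⟩) (c := c (a ⟨b, j⟩)) h3
    rw [← hn b j] at this
    simpa only [hl, val_zero_sub_one, ZMod.val_zero] using this
  · rw [hcard, hA, Fintype.card_sigma]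

theorem isRegularUnion_onePointUnion [Finite B] [Nontrivial B] [∀ b, Finite (J b)]
    [∀ b, NeZero (n b)] (C : ∀ b, CircuitCover (H b) p (J b) (n b)) (hp : 1 ≤ p) {q : ℕ}
    (hq : {b | ¬ IsCirculant (H b).graph}.ncard ≤ q) :
    IsRegularUnion (2 * p) q (onePointUnion H) :=
  ⟨B, H, inferInstance, inferInstance, fun b => ⟨(C b).finite_V hp, (C b).connected hp,
    (C b).isBipartite, (C b).ncard_neighborSet⟩, hq, ⟨SimpleGraph.Iso.refl⟩⟩

end Blocks

/-! ### The two label schemes -/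

section Schemes

variable {r : ℕ}

/-- Remainders run over 1, ..., d instead of 0, ..., d-1, so that the labels, which start at 1, have
quotients starting at 0. -/
theorem mul_add_unique {d U U' R R' : ℕ} (hR : 1 ≤ R) (hRd : R ≤ d) (hR' : 1 ≤ R') (hRd' : R' ≤ d)
    (h : R + U * d = R' + U' * d) : R = R' ∧ U = U' := by
  have key : ∀ {R U : ℕ}, 1 ≤ R → R ≤ d → (R + U * d - 1) / d = U := by
    intro R U h1 h2
    rw [show R + U * d - 1 = R - 1 + U * d by lia, Nat.add_mul_div_right _ _ (by lia),
      Nat.div_eq_of_lt (by lia), zero_add]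
  have hU : U = U' := by rw [← key (U := U) hR hRd, h, key hR' hRd']
  subst hU
  exact ⟨by lia, rfl⟩

/-- The labels of `r - 1` closed trails of length `4 * r - 2` and one of length `2 * r - 2`. -/
theorem labelScheme_first (hr : 2 ≤ r) :
    LabelScheme (insert (2 * r - 1) (Finset.Icc 1 (r - 1))) (2 * r - 1)
      ((2 * r - 1) * (2 * r - 1))
      (fun a => if a < r then 2 * r - 1 - a else r * (2 * r - 1))
      (fun a => if a < r then 2 * r - 1 else r - 1) := by
  obtain ⟨u, rfl⟩ := Nat.exists_eq_add_of_le hr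
  have hd : 2 * (2 + u) - 1 = 2 * u + 3 := by lia
  have hr1 : 2 + u - 1 = u + 1 := by lia
  rw [hd, hr1]
  have hnot : 2 * u + 3 ∉ Finset.Icc 1 (u + 1) := by simp; lia
  have hmem : ∀ a, a ∈ insert (2 * u + 3) (Finset.Icc 1 (u + 1)) →
      a = 2 * u + 3 ∧ ¬ a < 2 + u ∨ 1 ≤ a ∧ a ≤ u + 1 ∧ a < 2 + u := by
    intro a ha
    rw [Finset.mem_insert, Finset.mem_Icc] at ha
    lia
  refine ⟨by lia, ?_, ?_, ?_, ?_⟩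
  · intro a ha
    rcases hmem a ha with ⟨rfl, h⟩ | ⟨h1, h2, h⟩
    · rw [if_neg h, if_neg h, Nat.add_sub_cancel]
      refine ⟨by lia, by nlinarith, by lia, by ring⟩
    · rw [if_pos h, if_pos h]
      refine ⟨by lia, by lia, by lia, ?_⟩
      rw [show 2 * u + 3 - 1 = 2 * u + 2 by lia, Nat.add_sub_cancel' (by lia)]
      ring
  -- R is the residue and U the quotient of a label. With r = u + 2 and d = 2r-1, a trail with a < r
  -- fills class a at even positions and class d-a at odd ones. The exceptional trail fills class d:
  -- U runs over 0, ..., u at even and u+1, ..., 2u+1 at odd positions.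
  · have key : ∀ a ∈ insert (2 * u + 3) (Finset.Icc 1 (u + 1)), ∀ I < 2 * (if a < 2 + u then
        2 * u + 3 else u + 1), ∃ R U, 1 ≤ R ∧ R ≤ 2 * u + 3 ∧
        trailLabel (2 * u + 3) a (if a < 2 + u then 2 * u + 3 - a else (2 + u) * (2 * u + 3))
          (if a < 2 + u then 2 * u + 3 else u + 1) I = R + U * (2 * u + 3) ∧
        (a < 2 + u → I % 2 = 0 → R = a ∧ U = I / 2) ∧
        (a < 2 + u → I % 2 = 1 → R = 2 * u + 3 - a ∧ U = 2 * u + 2 - I / 2) ∧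
        (¬ a < 2 + u → I % 2 = 0 → R = 2 * u + 3 ∧ U = I / 2) ∧
        (¬ a < 2 + u → I % 2 = 1 → R = 2 * u + 3 ∧ U = 2 * u + 1 - I / 2) := by
      intro a ha I hI
      rcases hmem a ha with ⟨rfl, h⟩ | ⟨h1, h2, h⟩
      · rw [if_neg h] at hI
        simp only [if_neg h, trailLabel]
        rcases Nat.mod_two_eq_zero_or_one I with h0 | h0
        · exact ⟨2 * u + 3, I / 2, by lia, by lia, by rw [if_pos h0], by lia, by lia, by lia,
            by lia⟩
        · refine ⟨2 * u + 3, 2 * u + 1 - I / 2, by lia, by lia, ?_, by lia, by lia, by lia, by lia⟩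
          rw [if_neg (by lia), Nat.add_sub_cancel,
            show 2 * u + 1 - I / 2 = (u - I / 2) + (u + 1) by lia]
          ring
      · rw [if_pos h] at hI
        simp only [if_pos h, trailLabel]
        rcases Nat.mod_two_eq_zero_or_one I with h0 | h0
        · exact ⟨a, I / 2, by lia, by lia, by rw [if_pos h0], by lia, by lia, by lia, by lia⟩
        · exact ⟨2 * u + 3 - a, 2 * u + 2 - I / 2, by lia, by lia, by rw [if_neg (by lia)]; rfl,
            by lia, by lia, by lia, by lia⟩
    intro a ha a' ha' I hI I' hI' h
    obtain ⟨R, U, h1, h2, h3, h4⟩ := key a ha I hI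
    obtain ⟨R', U', h1', h2', h3', h4'⟩ := key a' ha' I' hI'
    rw [h3, h3'] at h
    obtain ⟨rfl, rfl⟩ := mul_add_unique h1 h2 h1' h2' h
    clear h h3 h3' key
    have := hmem a ha
    have := hmem a' ha'
    split_ifs at hI hI' <;> lia
  · rw [Finset.sum_insert hnot, if_neg (by lia), Finset.sum_congr rfl (g := fun _ => 2 * u + 3),
      Finset.sum_const, Nat.card_Icc, smul_eq_mul, Nat.add_sub_cancel]
    · ring
    · intro a ha
      rw [Finset.mem_Icc] at ha
      rw [if_pos (by lia)]; lia
  · rw [Finset.sum_insert hnot, if_neg (by lia), Finset.sum_congr rfl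
      (g := fun _ => 2 * (2 * u + 3)), Finset.sum_const, Nat.card_Icc, smul_eq_mul,
      Nat.add_sub_cancel]
    · ring
    · intro a ha
      rw [Finset.mem_Icc] at ha
      rw [if_pos (by lia)]

/-- The labels of `(r - 1) / 2` closed trails of length `2 * r` and `(r + 1) / 2` closed trails of
length `2 * r - 2`. -/
theorem labelScheme_second {w : ℕ} (hw : 1 ≤ w) :
    LabelScheme (Finset.Icc 1 w ∪ Finset.Icc (2 * w + 1) (3 * w + 1)) (2 * (2 * w + 1))
      ((2 * w + 1) * (4 * w + 1))
      (fun a => if a ≤ w then 2 * w + 1 - a else 3 * (2 * w + 1) - a)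
      (fun a => if a ≤ w then 2 * w + 1 else 2 * w) := by
  have hdisj : Disjoint (Finset.Icc 1 w) (Finset.Icc (2 * w + 1) (3 * w + 1)) := by
    rw [Finset.disjoint_left]
    intro a h1 h2
    rw [Finset.mem_Icc] at h1 h2
    lia
  have hmem : ∀ a, a ∈ Finset.Icc 1 w ∪ Finset.Icc (2 * w + 1) (3 * w + 1) →
      1 ≤ a ∧ a ≤ w ∨ ¬ a ≤ w ∧ 2 * w + 1 ≤ a ∧ a ≤ 3 * w + 1 := by
    intro a ha
    rw [Finset.mem_union, Finset.mem_Icc, Finset.mem_Icc] at ha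
    lia
  refine ⟨by lia, ?_, ?_, ?_, ?_⟩
  · intro a ha
    rcases hmem a ha with ⟨h1, h⟩ | ⟨h, h1, h2⟩
    · rw [if_pos h, if_pos h, Nat.add_sub_cancel, Nat.add_sub_cancel' (by lia)]
      exact ⟨by lia, by lia, by lia, by ring⟩
    · rw [if_neg h, if_neg h, Nat.add_sub_cancel' (by lia)]
      refine ⟨by lia, by lia, by lia, ?_⟩
      obtain ⟨v, rfl⟩ := Nat.exists_eq_add_of_le hw
      rw [show 2 * (1 + v) - 1 = 2 * v + 1 by lia]
      ring
  -- With r = 2w+1 and d = 2r, the pairs {a, r-a} fill the classes 1, ..., 2w with r labels each,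
  -- and the pairs {a, 3r-a} fill the classes r, ..., 2r with r-1 labels each.
  · have key : ∀ a ∈ Finset.Icc 1 w ∪ Finset.Icc (2 * w + 1) (3 * w + 1), ∀ I < 2 *
        (if a ≤ w then 2 * w + 1 else 2 * w), ∃ R U, 1 ≤ R ∧ R ≤ 2 * (2 * w + 1) ∧
        trailLabel (2 * (2 * w + 1)) a (if a ≤ w then 2 * w + 1 - a else 3 * (2 * w + 1) - a)
          (if a ≤ w then 2 * w + 1 else 2 * w) I = R + U * (2 * (2 * w + 1)) ∧
        (a ≤ w → I % 2 = 0 → R = a ∧ U = I / 2) ∧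
        (a ≤ w → I % 2 = 1 → R = 2 * w + 1 - a ∧ U = 2 * w - I / 2) ∧
        (¬ a ≤ w → I % 2 = 0 → R = a ∧ U = I / 2) ∧
        (¬ a ≤ w → I % 2 = 1 → R = 3 * (2 * w + 1) - a ∧ U = 2 * w - 1 - I / 2) := by
      intro a ha I hI
      rcases hmem a ha with ⟨h1, h⟩ | ⟨h, h1, h2⟩
      · rw [if_pos h] at hI
        simp only [if_pos h, trailLabel]
        rcases Nat.mod_two_eq_zero_or_one I with h0 | h0
        · exact ⟨a, I / 2, by lia, by lia, by rw [if_pos h0], by lia, by lia, by lia, by lia⟩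
        · exact ⟨2 * w + 1 - a, 2 * w - I / 2, by lia, by lia, by rw [if_neg (by lia)]; rfl,
            by lia, by lia, by lia, by lia⟩
      · rw [if_neg h] at hI
        simp only [if_neg h, trailLabel]
        rcases Nat.mod_two_eq_zero_or_one I with h0 | h0
        · exact ⟨a, I / 2, by lia, by lia, by rw [if_pos h0], by lia, by lia, by lia, by lia⟩
        · exact ⟨3 * (2 * w + 1) - a, 2 * w - 1 - I / 2, by lia, by lia, by rw [if_neg (by lia)],
            by lia, by lia, by lia, by lia⟩
    intro a ha a' ha' I hI I' hI' h
    obtain ⟨R, U, h1, h2, h3, h4⟩ := key a ha I hI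
    obtain ⟨R', U', h1', h2', h3', h4'⟩ := key a' ha' I' hI'
    rw [h3, h3'] at h
    obtain ⟨rfl, rfl⟩ := mul_add_unique h1 h2 h1' h2' h
    clear h h3 h3' key
    have := hmem a ha
    have := hmem a' ha'
    split_ifs at hI hI' <;> lia
  · rw [Finset.sum_union hdisj, Finset.sum_congr rfl (g := fun _ => 2 * w + 1),
      Finset.sum_const, Nat.card_Icc, smul_eq_mul, Nat.add_sub_cancel,
      Finset.sum_congr rfl (g := fun _ => 3 * (2 * w + 1)), Finset.sum_const, Nat.card_Icc,
      smul_eq_mul, show 3 * w + 1 + 1 - (2 * w + 1) = w + 1 by lia]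
    · ring
    · intro a ha
      rw [Finset.mem_Icc] at ha
      rw [if_neg (by lia)]; lia
    · intro a ha
      rw [Finset.mem_Icc] at ha
      rw [if_pos (by lia)]; lia
  · rw [Finset.sum_union hdisj, Finset.sum_congr rfl (g := fun _ => 2 * (2 * w + 1)),
      Finset.sum_const, Nat.card_Icc, smul_eq_mul, Nat.add_sub_cancel,
      Finset.sum_congr rfl (g := fun _ => 2 * (2 * w)), Finset.sum_const, Nat.card_Icc,
      smul_eq_mul, show 3 * w + 1 + 1 - (2 * w + 1) = w + 1 by lia]
    · ring
    · intro a ha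
      rw [Finset.mem_Icc] at ha
      rw [if_neg (by lia)]
    · intro a ha
      rw [Finset.mem_Icc] at ha
      rw [if_pos (by lia)]

end Schemes

/-! ### Merging a cycle in pairs without multiple edges -/

/-- The class of the vertex `v` of the cycle of length `4 * h`: the even vertices `2 * m` and
`2 * (m + h)`, and the odd vertices `2 * m + 1` and `2 * (m + 2 + h) + 1`, are merged (with `m + 2`
modulo `h`). -/
def mergeClass (h v : ℕ) : ℕ :=
  if v % 2 = 0 then (if v < 2 * h then v else v - 2 * h)
  else if v < 2 * h then v else if 2 * h + 4 < v then v - 2 * h - 4 else v - 4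

theorem mergeClass_mod {h v : ℕ} (hh : 4 ≤ h) : mergeClass h v % 2 = v % 2 := by
  unfold mergeClass
  split_ifs <;> lia

theorem mergeClass_eq_iff {h v : ℕ} (hh : 4 ≤ h) (hv : v < 4 * h) :
    ∃ A < 4 * h, ∃ B < 4 * h, A ≠ B ∧
      ∀ w < 4 * h, mergeClass h v = mergeClass h w ↔ w = A ∨ w = B := by
  have hc : mergeClass h v < 2 * h := by unfold mergeClass; split_ifs <;> lia
  generalize mergeClass h v = c at hc
  rcases Nat.mod_two_eq_zero_or_one c with h0 | h0
  · refine ⟨c, by lia, c + 2 * h, by lia, by lia, fun w hw => ?_⟩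
    unfold mergeClass; split_ifs <;> lia
  · refine ⟨c, by lia, if c + 4 < 2 * h then c + 4 + 2 * h else c + 4, by split_ifs <;> lia,
      by split_ifs <;> lia, fun w hw => ?_⟩
    unfold mergeClass; split_ifs <;> lia

/-- The ends of an edge are one step apart, so from one edge to another the cyclic shifts of the
even and of the odd end differ by at most 2. Merged even vertices are shifted by 0 or 2h, merged odd
ones by 0, ±4 or ±(2h+4). Unless both shifts vanish, these are at least 4 apart modulo 4h; this
needs 2h-4 ≥ 4. -/
theorem mergeClass_edge_unique {h e o e' o' : ℕ} (hh : 4 ≤ h) (he : e < 4 * h) (he' : e' < 4 * h)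
    (ho : o < 4 * h) (ho' : o' < 4 * h) (he2 : e % 2 = 0) (he2' : e' % 2 = 0) (ho2 : o % 2 = 1)
    (ho2' : o' % 2 = 1) (h1 : o = e + 1 ∨ e = o + 1 ∨ o + 1 = 4 * h ∧ e = 0)
    (h2 : o' = e' + 1 ∨ e' = o' + 1 ∨ o' + 1 = 4 * h ∧ e' = 0)
    (h3 : mergeClass h e = mergeClass h e') (h4 : mergeClass h o = mergeClass h o') :
    e = e' ∧ o = o' := by
  have heven : e = e' ∨ e = e' + 2 * h ∨ e' = e + 2 * h := by
    unfold mergeClass at h3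
    rw [if_pos he2, if_pos he2'] at h3
    split_ifs at h3 <;> omega
  have hodd : o = o' ∨ (o = o' + 2 * h + 4 ∨ o' < 2 * h ∧ o = o' + 4 ∧ 2 * h ≤ o) ∨
      (o' = o + 2 * h + 4 ∨ o < 2 * h ∧ o' = o + 4 ∧ 2 * h ≤ o') := by
    unfold mergeClass at h4
    rw [if_neg (show ¬ o % 2 = 0 by omega), if_neg (show ¬ o' % 2 = 0 by omega)] at h4
    split_ifs at h4 <;> omega
  clear h3 h4
  rcases hodd with rfl | hodd | hodd <;> rcases heven with rfl | rfl | rfl <;>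
    rcases h1 with h1 | h1 | h1 <;> rcases h2 with h2 | h2 | h2 <;> omega

/-- Classes preserve parity, so even ends are matched with even ends. A match in reversed
orientation would give v = w' and v' = w, impossible on so long a cycle. -/
theorem mergeClass_edge {h v w v' w' : ℕ} (hh : 4 ≤ h)
    (hv : v + 1 < 4 * h ∧ v' = v + 1 ∨ v + 1 = 4 * h ∧ v' = 0)
    (hw : w + 1 < 4 * h ∧ w' = w + 1 ∨ w + 1 = 4 * h ∧ w' = 0)
    (he : mergeClass h v = mergeClass h w ∧ mergeClass h v' = mergeClass h w' ∨
      mergeClass h v = mergeClass h w' ∧ mergeClass h v' = mergeClass h w) : v = w := by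
  have hmod : ∀ {a b}, mergeClass h a = mergeClass h b → a % 2 = b % 2 := fun hab => by
    rw [← mergeClass_mod hh, hab, mergeClass_mod hh]
  rcases he with ⟨h1, h2⟩ | ⟨h1, h2⟩ <;> have h3 := hmod h1 <;> have h4 := hmod h2 <;>
    rcases Nat.mod_two_eq_zero_or_one v with h0 | h0
  · exact (mergeClass_edge_unique hh (by omega) (by omega) (by omega) (by omega) (by omega)
      (by omega) (by omega) (by omega) (by omega) (by omega) h1 h2).1
  · exact (mergeClass_edge_unique hh (by omega) (by omega) (by omega) (by omega) (by omega)
      (by omega) (by omega) (by omega) (by omega) (by omega) h2 h1).2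
  · have := mergeClass_edge_unique hh (by omega) (by omega) (by omega) (by omega) (by omega)
      (by omega) (by omega) (by omega) (by omega) (by omega) h1 h2
    omega
  · have := mergeClass_edge_unique hh (by omega) (by omega) (by omega) (by omega) (by omega)
      (by omega) (by omega) (by omega) (by omega) (by omega) h2 h1
    omega

/-! ### Existence of pairings and jump sets -/

section Existence

theorem ncard_val_eq_or {n : ℕ} [NeZero n] {A B : ℕ} (hA : A < n) (hB : B < n) (hAB : A ≠ B) :
    {y : ZMod n | y.val = A ∨ y.val = B}.ncard = 2 := by
  have h : {y : ZMod n | y.val = A ∨ y.val = B} = {(A : ZMod n), (B : ZMod n)} := by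
    have key : ∀ (y : ZMod n) {C : ℕ}, C < n → (y.val = C ↔ y = C) := fun y C hC => by
      rw [← (ZMod.val_injective n).eq_iff, ZMod.val_natCast, Nat.mod_eq_of_lt hC]
    ext y
    simp only [Set.mem_ofPred_eq, Set.mem_insert_iff, Set.mem_singleton_iff, key y hA, key y hB]
  rw [h, Set.ncard_pair]
  exact fun h => hAB (natCast_inj_of_lt hA hB h)

theorem val_add_one_cases {n : ℕ} [NeZero n] (i : ZMod n) :
    i.val + 1 < n ∧ (i + 1).val = i.val + 1 ∨ i.val + 1 = n ∧ (i + 1).val = 0 := by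
  have h1 : (i + 1).val = (i.val + 1) % n := by
    rw [← ZMod.val_natCast, Nat.cast_succ, ZMod.natCast_zmod_val]
  have h2 := ZMod.val_lt i
  rcases Nat.lt_or_ge (i.val + 1) n with h | h
  · exact Or.inl ⟨h, by rw [h1, Nat.mod_eq_of_lt h]⟩
  · have h3 : i.val + 1 = n := by lia
    exact Or.inr ⟨h3, by rw [h1, h3, Nat.mod_self]⟩

/-- The vertices of a cycle whose length is a multiple of four and at least sixteen can be merged
in pairs of the same parity without creating multiple edges. -/
theorem exists_mergesSimply {h : ℕ} (hh : 4 ≤ h) :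
    ∃ P : Setoid (ZMod (4 * h)), IsParityPairing (4 * h) P ∧ MergesSimply (4 * h) P := by
  have : NeZero (4 * h) := ⟨by lia⟩
  set P : Setoid (ZMod (4 * h)) := Setoid.ker fun x => mergeClass h x.val with hP
  have hPr : ∀ x y, P x y ↔ mergeClass h x.val = mergeClass h y.val := fun x y => Iff.rfl
  have hpar : ∀ x y, P x y → x.val % 2 = y.val % 2 := fun x y hxy => by
    rw [← mergeClass_mod hh, (hPr x y).mp hxy, mergeClass_mod hh]
  have hedge := bijOn_cycle_edgeSet (n := 4 * h) (by lia)
  refine ⟨P, ⟨fun x => ?_, hpar⟩, fun x y hxy hP' => ?_, ?_⟩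
  · obtain ⟨A, hA, B, hB, hAB, hiff⟩ := mergeClass_eq_iff hh (ZMod.val_lt x)
    rw [← ncard_val_eq_or hA hB hAB]
    congr 1
    ext y
    exact (hPr x y).trans (hiff y.val (ZMod.val_lt y))
  · obtain ⟨i, -, hi⟩ := hedge.surjOn ((SimpleGraph.mem_edgeSet _).mpr hxy)
    have h1 := hpar x y hP'
    have h2 := val_add_one_cases i
    rcases Sym2.eq_iff.mp hi with ⟨rfl, rfl⟩ | ⟨rfl, rfl⟩ <;> lia
  · intro e he e' he' hee
    obtain ⟨i, -, rfl⟩ := hedge.surjOn he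
    obtain ⟨j, -, rfl⟩ := hedge.surjOn he'
    have hij : i.val = j.val := by
      refine mergeClass_edge hh (val_add_one_cases i) (val_add_one_cases j) ?_
      exact (Sym2.eq_iff.mp hee).imp (fun h => ⟨Quotient.exact h.1, Quotient.exact h.2⟩)
        (fun h => ⟨Quotient.exact h.1, Quotient.exact h.2⟩)
    rw [ZMod.val_injective _ hij]

theorem isJumpSet_pair {m a : ℕ} (hm : 2 < m) (h1 : 1 < a) (h2 : 2 * a < m)
    (h3 : Nat.Coprime a m) : IsJumpSet m 2 {1, a} := by
  refine ⟨Finset.card_pair (by lia), by simp, ?_⟩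
  intro b hb
  rcases Finset.mem_insert.mp hb with rfl | hb
  · exact ⟨by lia, Nat.coprime_one_left _⟩
  · rw [Finset.mem_singleton.mp hb]; exact ⟨h2, h3⟩

theorem exists_isJumpSet_two_mul_odd {q u : ℕ} (hq : Odd q) (hu : 2 ^ u + 1 < q) :
    ∃ S, IsJumpSet (2 * q) (u + 1) S := by
  have hpow : ∀ i ∈ Finset.range u, 2 ^ (i + 1) ≤ 2 ^ u := fun i hi =>
    Nat.pow_le_pow_right (by lia) (Finset.mem_range.mp hi)
  -- For odd q, the number q - 2^(i+1) is odd, and a common divisor with q would divide a power of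
  -- two. The bound on q keeps these numbers above 1.
  refine ⟨insert 1 ((Finset.range u).image fun i => q - 2 ^ (i + 1)), ?_, by simp, ?_⟩
  · rw [Finset.card_insert_of_notMem, Finset.card_image_of_injOn, Finset.card_range]
    · intro i hi j hj hij
      have h1 := hpow i hi
      have h2 := hpow j hj
      have h3 : 2 ^ (i + 1) = 2 ^ (j + 1) := by simp only at hij; lia
      have := Nat.pow_right_injective le_rfl h3
      lia
    · intro h
      obtain ⟨i, hi, h⟩ := Finset.mem_image.mp h
      have := hpow i hi
      lia
  · intro a ha
    rcases Finset.mem_insert.mp ha with rfl | ha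
    · exact ⟨by lia, Nat.coprime_one_left _⟩
    · obtain ⟨i, hi, rfl⟩ := Finset.mem_image.mp ha
      have h1 := hpow i hi
      have h2 : 0 < 2 ^ (i + 1) := by positivity
      refine ⟨by lia, Nat.Coprime.mul_right ?_ ?_⟩
      · rw [Nat.coprime_two_right]
        exact Nat.Odd.sub_even (by lia) hq (by rw [pow_succ']; exact even_two_mul _)
      · rw [Nat.coprime_self_sub_left (by lia)]
        exact Nat.Coprime.pow_left _ (Nat.coprime_two_left.mpr hq)

theorem exists_isJumpSet_two_pow {e p : ℕ} (hp : 1 ≤ p) (he : 4 * p ≤ 2 ^ e) :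
    ∃ S, IsJumpSet (2 ^ e) p S := by
  refine ⟨(Finset.range p).image fun i => 2 * i + 1, ?_, ?_, ?_⟩
  · rw [Finset.card_image_of_injective _ (fun i j h => by lia), Finset.card_range]
  · exact Finset.mem_image.mpr ⟨0, Finset.mem_range.mpr hp, rfl⟩
  · intro a ha
    obtain ⟨i, hi, rfl⟩ := Finset.mem_image.mp ha
    have := Finset.mem_range.mp hi
    exact ⟨by lia, Nat.Coprime.pow_right _ (by rw [Nat.coprime_two_right]; exact ⟨i, rfl⟩)⟩

end Existence

/-! ### Distinguishing graphs by their numbers of edges -/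

section Infinite

theorem ncard_edgeSet_eq_of_iso {V W : Type} {G : SimpleGraph V} {G' : SimpleGraph W}
    (e : G ≃g G') : G.edgeSet.ncard = G'.edgeSet.ncard := by
  rw [← Nat.card_coe_set_eq, ← Nat.card_coe_set_eq]
  exact Nat.card_congr e.mapEdgeSet

theorem infinitelyMany_of_ncard_edgeSet {F : Set RootedGraph} {g : ℕ → ℕ}
    (hg : Function.Injective g) (h : ∀ k, ∃ G ∈ F, G.graph.edgeSet.ncard + 1 = g k) :
    InfinitelyMany F := by
  choose G hG hE using h
  refine ⟨G, hG, fun i j hij => ⟨fun e => hij (hg ?_)⟩⟩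
  rw [← hE, ← hE, ncard_edgeSet_eq_of_iso e]

end Infinite

/-! ### The two kinds of one-point unions -/

section Families

variable {p q r : ℕ} {K : RootedGraph}

theorem ncard_not_isCirculant_le {B : Type} {H : Option B → RootedGraph} {c : ℕ}
    (h : ∀ b, IsCirculant (H (some b)).graph) (hc : ¬ IsCirculant (H none).graph → 1 ≤ c) :
    {o | ¬ IsCirculant (H o).graph}.ncard ≤ c := by
  have hsub : {o | ¬ IsCirculant (H o).graph} ⊆ {none} := by
    rintro (_ | b) ho
    · rfl
    · exact absurd (h b) ho
  by_cases hn : IsCirculant (H none).graph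
  · have : {o | ¬ IsCirculant (H o).graph} = ∅ := by
      rw [Set.eq_empty_iff_forall_notMem]
      intro o ho
      obtain rfl := hsub ho
      exact ho hn
    rw [this, Set.ncard_empty]; lia
  · exact (Set.ncard_le_ncard hsub).trans ((Set.ncard_singleton _).le.trans (hc hn))

/-- Circulant graphs that arise from `r - 1` cycles of length `4 * r - 2`, and a graph that arises
from one cycle of length `2 * r - 2`. -/
theorem union_first (hp : 1 ≤ p) (hq : 1 ≤ q) (hqp : q * p + 1 = r)
    (C : CircuitCover K p Unit (2 * r - 2)) {S : Fin q → Finset ℕ}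
    (hS : ∀ h, IsJumpSet (4 * r - 2) p (S h)) {c : ℕ} (hc : ¬ IsCirculant K.graph → 1 ≤ c) :
    (HasChiLaTwo (onePointUnion fun i : Option (Fin q) =>
      i.elim K fun h => circulant (4 * r - 2) (S h)) ∧
    (onePointUnion fun i : Option (Fin q) =>
      i.elim K fun h => circulant (4 * r - 2) (S h)).graph.edgeSet.ncard + 1 =
        (2 * r - 1) * (2 * r - 1)) ∧
    IsRegularUnion (2 * p) c (onePointUnion fun i : Option (Fin q) =>
      i.elim K fun h => circulant (4 * r - 2) (S h)) := by
  have hqp1 : 1 ≤ q * p := Nat.mul_pos hq hp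
  set H : Option (Fin q) → RootedGraph :=
    fun i => i.elim K fun h => circulant (4 * r - 2) (S h) with hH
  set f : Option (Fin q) → ℕ := fun i => i.elim 1 fun _ => p with hf
  set n : Option (Fin q) → ℕ := fun i => i.elim (2 * r - 2) fun _ => 4 * r - 2 with hn
  -- Block h receives the p starting labels 1 + h*p, ..., p + h*p, and the block K the exceptional
  -- one, 2r-1.
  set base : Option (Fin q) → ℕ := fun i => i.elim (2 * r - 1) fun h => 1 + h * p with hbase
  have : ∀ o, NeZero (n o) := by
    rintro (_ | h) <;> exact ⟨by simp only [hn, Option.elim]; lia⟩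
  have : ∀ o, Nonempty (Fin (f o)) := by
    rintro (_ | h)
    · exact ⟨⟨0, Nat.one_pos⟩⟩
    · exact ⟨⟨0, hp⟩⟩
  have : Nontrivial (Option (Fin q)) := ⟨none, some ⟨0, hq⟩, by simp⟩
  -- A circulant block has one trail per jump, hence p of them; K has a single trail.
  have C' : ∀ o, CircuitCover (H o) p (Fin (f o)) (n o) := by
    rintro (_ | h)
    · exact C.reindex (Equiv.equivPUnit (Fin 1))
    · exact (circulantCover ⟨2 * r - 1, by lia⟩ (hS h)).reindex
        ((S h).equivFinOfCardEq (hS h).1).symm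
  have hlt : ∀ h : Fin q, h * p + p ≤ q * p := fun h => by
    rw [← Nat.succ_mul]; exact Nat.mul_le_mul_right p h.2
  refine ⟨hasChiLaTwo_of_labelScheme C' hp (labelScheme_first (r := r) (by lia))
    (a := fun t => base t.1 + t.2) ?_ ?_ ?_ ?_ ?_, isRegularUnion_onePointUnion C' hp
      (ncard_not_isCirculant_le (fun h => isCirculant_circulant (by lia)) hc)⟩
  · rintro ⟨_ | h, ⟨j, hj⟩⟩ ⟨_ | h', ⟨j', hj'⟩⟩ heq
    · simp only [hf, Option.elim] at hj hj'
      obtain rfl : j = j' := by lia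
      rfl
    · have := hlt h'
      simp only [hf, hbase, Option.elim] at hj hj' heq
      lia
    · have := hlt h
      simp only [hf, hbase, Option.elim] at hj hj' heq
      lia
    · simp only [hf, hbase, Option.elim] at hj hj' heq
      obtain ⟨h1, h2⟩ := mul_add_unique (d := p) (R := j + 1) (R' := j' + 1) (U := h) (U' := h')
        (by lia) (by lia) (by lia) (by lia) (by lia)
      obtain rfl := Fin.ext h2
      obtain rfl : j = j' := by lia
      rfl
  · rintro ⟨_ | h, ⟨j, hj⟩⟩
    · simp only [hf, hbase, Option.elim] at hj ⊢
      rw [Finset.mem_insert]; lia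
    · have := hlt h
      simp only [hf, hbase, Option.elim] at hj ⊢
      rw [Finset.mem_insert, Finset.mem_Icc]; lia
  · rintro (_ | h) ⟨j, hj⟩
    · simp only [hn, hbase, Option.elim]
      rw [if_neg (by lia)]; lia
    · have := hlt h
      simp only [hf, hn, hbase, Option.elim] at hj ⊢
      rw [if_pos (by lia)]; lia
  · rw [Finset.card_insert_of_notMem (by rw [Finset.mem_Icc]; lia), Nat.card_Icc]
    simp [hf]
    lia
  · rw [Finset.card_insert_of_notMem (by rw [Finset.mem_Icc]; lia), Nat.card_Icc]
    simp only [Fintype.card_option, Fintype.card_fin, add_mul, one_mul]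
    lia

/-- Circulant graphs that arise from `(r - 1) / 2` cycles of length `2 * r` and from `(r - 1) / 2`
cycles of length `2 * r - 2`, and a graph that arises from one more cycle of length `2 * r - 2`. -/
theorem union_second (hp : 1 ≤ p) (hq : 1 ≤ q) (hqp : 2 * (q * p) + 1 = r)
    (C : CircuitCover K p Unit (2 * r - 2)) {S T : Fin q → Finset ℕ}
    (hS : ∀ h, IsJumpSet (2 * r) p (S h)) (hT : ∀ h, IsJumpSet (2 * r - 2) p (T h)) {c : ℕ}
    (hc : ¬ IsCirculant K.graph → 1 ≤ c) :
    (HasChiLaTwo (onePointUnion fun i : Option (Fin q ⊕ Fin q) =>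
      i.elim K (Sum.elim (fun h => circulant (2 * r) (S h))
        fun h => circulant (2 * r - 2) (T h))) ∧
    (onePointUnion fun i : Option (Fin q ⊕ Fin q) =>
      i.elim K (Sum.elim (fun h => circulant (2 * r) (S h))
        fun h => circulant (2 * r - 2) (T h))).graph.edgeSet.ncard + 1 = r * (2 * r - 1)) ∧
    IsRegularUnion (2 * p) c (onePointUnion fun i : Option (Fin q ⊕ Fin q) =>
      i.elim K (Sum.elim (fun h => circulant (2 * r) (S h))
        fun h => circulant (2 * r - 2) (T h))) := by
  have hqp1 : 1 ≤ q * p := Nat.mul_pos hq hp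
  set H : Option (Fin q ⊕ Fin q) → RootedGraph := fun i => i.elim K (Sum.elim
    (fun h => circulant (2 * r) (S h)) fun h => circulant (2 * r - 2) (T h)) with hH
  set f : Option (Fin q ⊕ Fin q) → ℕ := fun i => i.elim 1 fun _ => p with hf
  set n : Option (Fin q ⊕ Fin q) → ℕ :=
    fun i => i.elim (2 * r - 2) (Sum.elim (fun _ => 2 * r) fun _ => 2 * r - 2) with hn
  -- With w = q*p, the blocks of order 2r share the labels 1, ..., w, those of order 2r-2 share
  -- 2w+1, ..., 3w, and K takes the last one, 3w+1.
  set base : Option (Fin q ⊕ Fin q) → ℕ := fun i => i.elim (3 * (q * p) + 1)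
    (Sum.elim (fun h => 1 + h * p) fun h => 2 * (q * p) + 1 + h * p) with hbase
  have : ∀ o, NeZero (n o) := by
    rintro (_ | h | h) <;> exact ⟨by simp only [hn, Option.elim, Sum.elim]; lia⟩
  have : ∀ o, Nonempty (Fin (f o)) := by
    rintro (_ | h)
    · exact ⟨⟨0, Nat.one_pos⟩⟩
    · exact ⟨⟨0, hp⟩⟩
  have : Nontrivial (Option (Fin q ⊕ Fin q)) := ⟨none, some (Sum.inl ⟨0, hq⟩), by simp⟩
  have C' : ∀ o, CircuitCover (H o) p (Fin (f o)) (n o) := by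
    rintro (_ | h | h)
    · exact C.reindex (Equiv.equivPUnit (Fin 1))
    · exact (circulantCover ⟨r, rfl⟩ (hS h)).reindex ((S h).equivFinOfCardEq (hS h).1).symm
    · exact (circulantCover ⟨r - 1, by lia⟩ (hT h)).reindex
        ((T h).equivFinOfCardEq (hT h).1).symm
  have hlt : ∀ h : Fin q, h * p + p ≤ q * p := fun h => by
    rw [← Nat.succ_mul]; exact Nat.mul_le_mul_right p h.2
  have huniq : ∀ (h h' : Fin q) {j j' : ℕ}, j < p → j' < p → h * p + j = h' * p + j' →
      h = h' ∧ j = j' := fun h h' {j j'} hj hj' heq => by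
    obtain ⟨h1, h2⟩ := mul_add_unique (d := p) (R := j + 1) (R' := j' + 1) (U := h) (U' := h')
      (by lia) (by lia) (by lia) (by lia) (by lia)
    exact ⟨Fin.ext h2, by lia⟩
  have hcard : (Finset.Icc 1 (q * p) ∪
      Finset.Icc (2 * (q * p) + 1) (3 * (q * p) + 1)).card = 2 * (q * p) + 1 := by
    rw [Finset.card_union_of_disjoint, Nat.card_Icc, Nat.card_Icc]
    · lia
    · rw [Finset.disjoint_left]
      intro a h1 h2
      rw [Finset.mem_Icc] at h1 h2
      lia
  have hx : (2 * (q * p) + 1) * (4 * (q * p) + 1) = r * (2 * r - 1) := by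
    rw [hqp]; congr 1; lia
  refine ⟨hx ▸ hasChiLaTwo_of_labelScheme C' hp (labelScheme_second hqp1)
    (a := fun t => base t.1 + t.2) ?_ ?_ ?_ ?_ ?_, isRegularUnion_onePointUnion C' hp
      (ncard_not_isCirculant_le ?_ hc)⟩
  · rintro ⟨_ | h | h, ⟨j, hj⟩⟩ ⟨_ | h' | h', ⟨j', hj'⟩⟩ heq <;>
      simp only [hf, hbase, Option.elim, Sum.elim] at hj hj' heq
    · obtain rfl : j = j' := by lia
      rfl
    · have := hlt h'; lia
    · have := hlt h'; lia
    · have := hlt h; lia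
    · obtain ⟨rfl, rfl⟩ := huniq h h' hj hj' (by lia)
      rfl
    · have := hlt h; omega
    · have := hlt h; lia
    · have := hlt h'; omega
    · obtain ⟨rfl, rfl⟩ := huniq h h' hj hj' (by lia)
      rfl
  · rintro ⟨_ | h | h, ⟨j, hj⟩⟩ <;> simp only [hf, hbase, Option.elim, Sum.elim] at hj ⊢ <;>
      rw [Finset.mem_union, Finset.mem_Icc, Finset.mem_Icc]
    · lia
    · have := hlt h; lia
    · have := hlt h; lia
  · rintro (_ | h | h) ⟨j, hj⟩ <;> simp only [hf, hn, hbase, Option.elim, Sum.elim] at hj ⊢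
    · rw [if_neg (by lia)]; lia
    · have := hlt h
      rw [if_pos (by lia)]; lia
    · rw [if_neg (by lia)]; lia
  · rw [hcard]
    simp [hf]
    lia
  · rw [hcard]
    simp only [Fintype.card_option, Fintype.card_sum, Fintype.card_fin, add_mul, one_mul]
    lia
  · rintro (h | h) <;> exact isCirculant_circulant (by lia)

end Families

/-! ### The four families: properties and members -/

theorem familyA_properties {r : ℕ} (hodd : Odd r) (hr : 9 ≤ r) {G : RootedGraph}
    (hG : G ∈ familyA r) : (HasChiLaTwo G ∧
      G.graph.edgeSet.ncard + 1 = (2 * r - 1) * (2 * r - 1)) ∧ IsRegularUnion 4 1 G := by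
  obtain ⟨a, P, ha, hP1, hP2, rfl⟩ := hG
  obtain ⟨w, rfl⟩ := hodd
  exact union_first (p := 2) (q := (2 * w + 1 - 1) / 2) (by lia) (by lia) (by lia)
    (mergedCycleCover ⟨2 * w, by lia⟩ (by lia) hP1 hP2)
    (fun h => isJumpSet_pair (by lia) (ha h).1 (by have := ha h; lia) (ha h).2.2) (fun _ => le_rfl)

theorem familyB_properties {r : ℕ} (hmod : r % 4 = 1) (hr : 9 ≤ r) {G : RootedGraph}
    (hG : G ∈ familyB r) : (HasChiLaTwo G ∧
      G.graph.edgeSet.ncard + 1 = r * (2 * r - 1)) ∧ IsRegularUnion 4 1 G := by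
  obtain ⟨a, b, P, ha, hb, hP1, hP2, rfl⟩ := hG
  exact union_second (p := 2) (q := (r - 1) / 4) (by lia) (by lia) (by lia)
    (mergedCycleCover ⟨r - 1, by lia⟩ (by lia) hP1 hP2)
    (fun h => isJumpSet_pair (by lia) (ha h).1 (by have := ha h; lia) (ha h).2.2)
    (fun h => isJumpSet_pair (by lia) (hb h).1 (by have := hb h; lia) (hb h).2.2)
    (fun _ => le_rfl)

theorem pow_two_mul_sub_two {s : ℕ} (hs : 2 ≤ s) :
    2 ^ (2 * s - 2) = 2 ^ (s - 1) * 2 ^ (s - 1) := by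
  rw [← pow_add]; congr 1; lia

theorem nonempty_jumpsCover {s t r : ℕ} (hs : 2 ≤ s) (hr : r = 2 ^ (2 * s - 2) * (t + 2) + 1) :
    Nonempty (CircuitCover (circulant (2 ^ s * (t + 2)) (jumps s t)) (2 ^ (s - 1)) Unit
      (2 * r - 2)) := by
  have h1 : 2 ^ s * (t + 2) = (2 * t + 4) * 2 ^ (s - 1) := by rw [(two_pow_eq hs).2]; ring
  have h2 : 2 * r - 2 = (2 * t + 4) * (2 ^ (s - 1) * 2 ^ (s - 1)) := by
    rw [hr, pow_two_mul_sub_two hs]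
    have : (2 * t + 4) * (2 ^ (s - 1) * 2 ^ (s - 1)) =
      2 * (2 ^ (s - 1) * 2 ^ (s - 1) * (t + 2)) := by ring
    lia
  rw [h1, h2]
  exact ⟨jumpsCover hs⟩

theorem familyC_properties {s t r : ℕ} (hs : 2 ≤ s) {G : RootedGraph} (hG : G ∈ familyC s t r) :
    (HasChiLaTwo G ∧ G.graph.edgeSet.ncard + 1 = (2 * r - 1) * (2 * r - 1)) ∧
      IsRegularUnion (2 ^ s) 0 G := by
  obtain ⟨hr, S, hS, rfl⟩ := hG
  obtain ⟨C⟩ := nonempty_jumpsCover hs hr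
  have hp : 1 ≤ 2 ^ (s - 1) := Nat.one_le_two_pow
  rw [(two_pow_eq hs).2] at C ⊢
  refine union_first hp (Nat.mul_pos hp (by lia)) ?_ C hS fun h => absurd ?_ h
  · rw [hr, pow_two_mul_sub_two hs]; ring
  · exact isCirculant_circulant (Nat.mul_pos (by positivity) (by lia))

theorem familyD_properties {s t r : ℕ} (hs : 2 ≤ s) {G : RootedGraph} (hG : G ∈ familyD s t r) :
    (HasChiLaTwo G ∧ G.graph.edgeSet.ncard + 1 = r * (2 * r - 1)) ∧
      IsRegularUnion (2 ^ s) 0 G := by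
  obtain ⟨hr, S, T, hS, hT, rfl⟩ := hG
  obtain ⟨C⟩ := nonempty_jumpsCover hs hr
  have hp : 1 ≤ 2 ^ (s - 1) := Nat.one_le_two_pow
  rw [(two_pow_eq hs).2] at C ⊢
  refine union_second hp (Nat.mul_pos (by positivity) (by lia)) ?_ C hS hT fun h => absurd ?_ h
  · rw [hr, pow_two_mul_sub_two hs, (two_pow_eq hs).1]; ring
  · exact isCirculant_circulant (Nat.mul_pos (by positivity) (by lia))

theorem exists_pairing {r : ℕ} (hodd : Odd r) (hr : 9 ≤ r) : ∃ P : Setoid (ZMod (2 * r - 2)),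
    IsParityPairing (2 * r - 2) P ∧ MergesSimply (2 * r - 2) P := by
  obtain ⟨w, rfl⟩ := hodd
  rw [show 2 * (2 * w + 1) - 2 = 4 * w by lia]
  exact exists_mergesSimply (by lia)

theorem coprime_two_mul_of_odd {a m : ℕ} (ha : Odd a) (h : Nat.Coprime a m) :
    Nat.Coprime a (2 * m) :=
  Nat.Coprime.mul_right (Nat.coprime_two_right.mpr ha) h

theorem coprime_sub_two {m : ℕ} (hm : Odd m) (h : 2 ≤ m) : Nat.Coprime (m - 2) m := by
  rw [Nat.coprime_self_sub_left h, Nat.coprime_two_left]; exact hm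

theorem familyA_nonempty {r : ℕ} (hodd : Odd r) (hr : 9 ≤ r) : (familyA r).Nonempty := by
  obtain ⟨P, hP1, hP2⟩ := exists_pairing hodd hr
  -- The jump is 2 less than the odd number 2r-1, hence odd and coprime to both factors of 4r-2.
  refine ⟨_, fun _ => 2 * r - 3, P, fun _ => ⟨by lia, by lia, ?_⟩, hP1, hP2, rfl⟩
  have h1 : Odd (2 * r - 1) := ⟨r - 1, by lia⟩
  have h2 : Odd (2 * r - 1 - 2) := ⟨r - 2, by lia⟩
  have := coprime_two_mul_of_odd h2 (coprime_sub_two h1 (by lia))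
  rwa [show 2 * r - 1 - 2 = 2 * r - 3 by lia, show 2 * (2 * r - 1) = 4 * r - 2 by lia] at this

theorem familyB_nonempty {r : ℕ} (hmod : r % 4 = 1) (hr : 9 ≤ r) : (familyB r).Nonempty := by
  have hodd : Odd r := ⟨r / 2, by lia⟩
  have hodd2 : Odd (r - 2) := ⟨r / 2 - 1, by lia⟩
  obtain ⟨P, hP1, hP2⟩ := exists_pairing hodd hr
  -- The odd number r-2 is coprime to r, which is odd, and to its successor r-1, so it serves for
  -- both orders 2r and 2r-2.
  refine ⟨_, fun _ => r - 2, fun _ => r - 2, P, fun _ => ⟨by lia, by lia,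
    coprime_two_mul_of_odd hodd2 (coprime_sub_two hodd (by lia))⟩, fun _ => ⟨by lia, by lia, ?_⟩,
    hP1, hP2, rfl⟩
  have h : Nat.Coprime (r - 2) (r - 2 + 1) := by simp
  have := coprime_two_mul_of_odd hodd2 h
  rwa [show 2 * (r - 2 + 1) = 2 * r - 2 by lia] at this

theorem injective_mul_two_mul_sub_one {g : ℕ → ℕ} (hg : StrictMono g) (h0 : ∀ k, 1 ≤ g k) :
    Function.Injective fun k => g k * (2 * g k - 1) := by
  refine StrictMono.injective fun i j hij => ?_
  have := hg hij
  have := h0 i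
  exact Nat.mul_lt_mul'' (by lia) (by lia)

theorem injective_two_mul_sub_one_sq {g : ℕ → ℕ} (hg : StrictMono g) (h0 : ∀ k, 1 ≤ g k) :
    Function.Injective fun k => (2 * g k - 1) * (2 * g k - 1) := by
  refine StrictMono.injective fun i j hij => ?_
  have := hg hij
  have := h0 i
  exact Nat.mul_lt_mul'' (by lia) (by lia)

theorem strictMono_two_pow_add_one {c : ℕ} : StrictMono fun k => 2 ^ (k + c) + 1 := by
  intro i j hij
  have := Nat.pow_lt_pow_right (a := 2) (by lia) (show i + c < j + c by lia)
  lia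

/-- The choice r = 2^e + 1 makes 2r-2 a power of two, for which all odd jumps are admissible. The
summand 2s-2 of e provides the required factor, and 2^(s-1) leaves a quotient t+2 of at least 2 and
makes r large enough for the jump sets of orders 2r and 4r-2. -/
theorem exists_parameters (s k : ℕ) : ∃ t,
    2 ^ (k + (2 * s - 2 + 2 ^ (s - 1))) + 1 = 2 ^ (2 * s - 2) * (t + 2) + 1 := by
  have h : 2 ^ 1 ≤ 2 ^ (k + 2 ^ (s - 1)) :=
    Nat.pow_le_pow_right (by lia) (by have := Nat.one_le_two_pow (n := s - 1); lia)
  refine ⟨2 ^ (k + 2 ^ (s - 1)) - 2, ?_⟩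
  rw [Nat.sub_add_cancel (by lia), ← pow_add]
  congr 2
  lia

theorem two_pow_lt (s k : ℕ) :
    2 ^ (2 ^ (s - 1) - 1) + 1 < 2 ^ (k + (2 * s - 2 + 2 ^ (s - 1))) + 1 := by
  have := Nat.one_le_two_pow (n := s - 1)
  have := Nat.pow_lt_pow_right (a := 2) (by lia)
    (show 2 ^ (s - 1) - 1 < k + (2 * s - 2 + 2 ^ (s - 1)) by lia)
  lia

theorem familyC_nonempty (s k : ℕ) :
    ∃ t, (familyC s t (2 ^ (k + (2 * s - 2 + 2 ^ (s - 1))) + 1)).Nonempty := by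
  obtain ⟨t, ht⟩ := exists_parameters s k
  have hlt := two_pow_lt s k
  set r := 2 ^ (k + (2 * s - 2 + 2 ^ (s - 1))) + 1 with hr
  obtain ⟨S, hS⟩ := exists_isJumpSet_two_mul_odd (q := 2 * r - 1) (u := 2 ^ (s - 1) - 1)
    ⟨r - 1, by lia⟩ (by lia)
  rw [Nat.sub_add_cancel Nat.one_le_two_pow, show 2 * (2 * r - 1) = 4 * r - 2 by lia] at hS
  exact ⟨t, _, ht, fun _ => S, fun _ => hS, rfl⟩

theorem familyD_nonempty {s : ℕ} (hs : 2 ≤ s) (k : ℕ) :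
    ∃ t, (familyD s t (2 ^ (k + (2 * s - 2 + 2 ^ (s - 1))) + 1)).Nonempty := by
  obtain ⟨t, ht⟩ := exists_parameters s k
  have hlt := two_pow_lt s k
  have hodd : Odd (2 ^ (k + (2 * s - 2 + 2 ^ (s - 1))) + 1) :=
    Even.add_one ((Nat.even_pow).mpr ⟨even_two, by lia⟩)
  obtain ⟨S, hS⟩ := exists_isJumpSet_two_mul_odd hodd hlt
  rw [Nat.sub_add_cancel Nat.one_le_two_pow] at hS
  obtain ⟨T, hT⟩ := exists_isJumpSet_two_pow (e := k + (2 * s - 2 + 2 ^ (s - 1)) + 1)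
    (p := 2 ^ (s - 1)) Nat.one_le_two_pow (by
      have := Nat.one_le_two_pow (n := s - 1)
      rw [show 4 * 2 ^ (s - 1) = 2 ^ (s - 1 + 2) by ring]
      exact Nat.pow_le_pow_right (by lia) (by lia))
  rw [pow_succ', show ∀ y, 2 * y = 2 * (y + 1) - 2 by lia] at hT
  exact ⟨t, _, ht, fun _ => S, fun _ => T, fun _ => hS, fun _ => hT, rfl⟩

end LocalAntimagic

open LocalAntimagic

theorem mainTheorem11 :
    -- every transformed graph is a one-point union of regular graphs with `χ_la = 2`
    (∀ r : ℕ, Odd r → 9 ≤ r → ∀ G ∈ familyA r, HasChiLaTwo G ∧ IsRegularUnion 4 1 G) ∧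
    (∀ r : ℕ, r % 4 = 1 → 9 ≤ r → ∀ G ∈ familyB r, HasChiLaTwo G ∧ IsRegularUnion 4 1 G) ∧
    (∀ s t r : ℕ, 2 ≤ s → ∀ G ∈ familyC s t r,
      HasChiLaTwo G ∧ IsRegularUnion (2 ^ s) 0 G) ∧
    (∀ s t r : ℕ, 2 ≤ s → ∀ G ∈ familyD s t r,
      HasChiLaTwo G ∧ IsRegularUnion (2 ^ s) 0 G) ∧
    -- the transformations are possible, and yield infinitely many graphs
    (∀ r : ℕ, Odd r → 9 ≤ r → (familyA r).Nonempty) ∧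
    (∀ r : ℕ, r % 4 = 1 → 9 ≤ r → (familyB r).Nonempty) ∧
    InfinitelyMany {G | ∃ r : ℕ, Odd r ∧ 9 ≤ r ∧ G ∈ familyA r} ∧
    InfinitelyMany {G | ∃ r : ℕ, r % 4 = 1 ∧ 9 ≤ r ∧ G ∈ familyB r} ∧
    (∀ s : ℕ, 2 ≤ s → InfinitelyMany {G | ∃ t r : ℕ, G ∈ familyC s t r}) ∧
    (∀ s : ℕ, 2 ≤ s → InfinitelyMany {G | ∃ t r : ℕ, G ∈ familyD s t r}) := by
  refine ⟨fun r h1 h2 G hG => ?_, fun r h1 h2 G hG => ?_, fun s t r hs G hG => ?_,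
    fun s t r hs G hG => ?_, fun r => familyA_nonempty, fun r => familyB_nonempty, ?_, ?_,
    fun s hs => ?_, fun s hs => ?_⟩
  · exact (familyA_properties h1 h2 hG).imp_left And.left
  · exact (familyB_properties h1 h2 hG).imp_left And.left
  · exact (familyC_properties hs hG).imp_left And.left
  · exact (familyD_properties hs hG).imp_left And.left
  -- One graph is taken for each r in an increasing sequence; its number of edges, one less than the
  -- x of the scheme, determines r.
  · refine infinitelyMany_of_ncard_edgeSet (injective_two_mul_sub_one_sq (g := fun k => 2 * k + 9)
      (fun i j hij => by lia) (fun k => by lia)) fun k => ?_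
    have hodd : Odd (2 * k + 9) := ⟨k + 4, by ring⟩
    obtain ⟨G, hG⟩ := familyA_nonempty hodd (by lia)
    exact ⟨G, ⟨_, hodd, by lia, hG⟩, (familyA_properties hodd (by lia) hG).1.2⟩
  · refine infinitelyMany_of_ncard_edgeSet (injective_mul_two_mul_sub_one (g := fun k => 4 * k + 9)
      (fun i j hij => by lia) (fun k => by lia)) fun k => ?_
    have hmod : (4 * k + 9) % 4 = 1 := by lia
    obtain ⟨G, hG⟩ := familyB_nonempty hmod (by lia)
    exact ⟨G, ⟨_, hmod, by lia, hG⟩, (familyB_properties hmod (by lia) hG).1.2⟩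
  · refine infinitelyMany_of_ncard_edgeSet (injective_two_mul_sub_one_sq
      (strictMono_two_pow_add_one (c := 2 * s - 2 + 2 ^ (s - 1))) (fun k => by lia)) fun k => ?_
    obtain ⟨t, G, hG⟩ := familyC_nonempty s k
    exact ⟨G, ⟨t, _, hG⟩, (familyC_properties hs hG).1.2⟩
  · refine infinitelyMany_of_ncard_edgeSet (injective_mul_two_mul_sub_one
      (strictMono_two_pow_add_one (c := 2 * s - 2 + 2 ^ (s - 1))) (fun k => by lia)) fun k => ?_
    obtain ⟨t, G, hG⟩ := familyD_nonempty hs k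
    exact ⟨G, ⟨t, _, hG⟩, (familyD_properties hs hG).1.2⟩
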